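/- For a finite group $H$ let $\mathrm{ccl}(H)$ denote the number of conjugacy classes of $H$. Let $\pi$ be a set of primes and $\pi'$ the set of all primes not in $\pi$. A Hall $\pi$-subgroup of a finite group is a subgroup whose order is divisible only by primes in $\pi$ and whose index is divisible by no prime in $\pi$. A finite soluble group $G$ with Hall $\pi$-subgroup $A$ and Hall $\pi'$-subgroup $B$ (these exist and are unique up to conjugacy by Hall's theorem) is called $\mathrm{Con}_\pi^*$ if either $\mathrm{ccl}(G)<\mathrm{ccl}(A)\,\mathrm{ccl}(B)$ or $G\cong A\times B$. Proposition. Let $\pi$ be a set of primes. Let $G$ be a finite soluble group of order at most $2000$, and suppose that $G$ is a minimal counterexample to the assertion "every finite soluble group is $\mathrm{Con}_\pi^*$"; that is, $G$ is not $\mathrm{Con}_\pi^*$, but every proper section of $G$ (every quotient $K/N$ with $N\trianglelefteq K\le G$ and $(K,N)\neq(G,1)$) is $\mathrm{Con}_\pi^*$. Then $|G|$ is one of $$336,\ 672,\ 1008,\ 1200,\ 1296,\ 1344,\ 1680.$$ -/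

import Mathlib

/-- The class number `ccl(G)`: the number of conjugacy classes of `G`. -/
noncomputable def ccl (G : Type*) [Group G] : ℕ := Nat.card (ConjClasses G)

/-- `n` is a `π`-number: every prime divisor of `n` lies in the set of primes `π`. -/
def IsPiNumber (π : Set Nat.Primes) (n : ℕ) : Prop :=
  ∀ p : Nat.Primes, (p : ℕ) ∣ n → p ∈ π

/-- `H` is a Hall `π`-subgroup of the finite group `G`: its order is a `π`-number and its index is
a `π'`-number, where `π' = πᶜ` is the complement of `π` in the set of all primes. -/
def IsHallSubgroup (π : Set Nat.Primes) {G : Type*} [Group G] (H : Subgroup G) : Prop :=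
  IsPiNumber π (Nat.card H) ∧ IsPiNumber πᶜ H.index

/-- The property `Con*_π` of a finite soluble group `G`: for a Hall `π`-subgroup `A` and a Hall
`π'`-subgroup `B` of `G`, either `ccl(G) < ccl(A) ccl(B)` or `G ≅ A × B`.
In a finite soluble group such `A` and `B` exist and are unique up to conjugacy (Hall's theorem),
so it does not matter which ones are taken. -/
def IsConStar (π : Set Nat.Primes) (G : Type*) [Group G] : Prop :=
  ∀ A B : Subgroup G, IsHallSubgroup π A → IsHallSubgroup πᶜ B →
    ccl G < ccl A * ccl B ∨ Nonempty (G ≃* A × B)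

/-- `G` is a minimal counterexample to the assertion that every finite soluble group is `Con*_π`:
`G` is a finite soluble group which is not `Con*_π`, but every proper section `K / N` of `G`
(with `N` normal in `K ≤ G` and not both `K = G` and `N = 1`) is `Con*_π`. -/
structure IsMinimalConStarCounterexample (π : Set Nat.Primes) (G : Type*) [Group G] : Prop where
  finite : Finite G
  soluble : Group.IsSolvable G
  not_conStar : ¬ IsConStar π G
  section_conStar : ∀ (K : Subgroup G) (N : Subgroup K) [N.Normal],
    (K ≠ ⊤ ∨ N ≠ ⊥) → IsConStar π (K ⧸ N)

/-! Let `A` and `B` be Hall subgroups witnessing the failure of `G`. Constraints on the orders of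
`A`, `B` and `G` leave only the listed values.

Every class of `G` contains a product of commuting elements, with `b` a chosen class representative
of `B` and `a` in a Hall π-subgroup of `C_G(b)`, which is conjugate into `A`. If proper subgroups of
`A` have fewer classes than `A`, each `b` contributes at most `ccl A`, with equality only when `b`
centralizes a conjugate of `A`. Equality throughout makes `C_B(A)` meet every class of `B`, so
`C_B(A) = B` and `G ≅ A × B` (`IsHallSubgroup.ccl_lt_or_of_forall_ccl_lt`). Hence neither Hall
subgroup is abelian or of order the cube of a prime.

A normal subgroup `P` of prime order `p` forces `p ^ 2 ∣ |G|`
(`IsMinimalConStarCounterexample.sq_dvd`). Otherwise `P` has a complement `H`, the number of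
commuting pairs of `G` is a positive combination of those of `H` and `C_H(P)` (`commPairs_sup`), and
minimality applies to both of these subgroups.

So a prime `p` dividing `|G|` exactly once has a non-normal Sylow subgroup. By solubility it acts
nontrivially on a normal `q`-subgroup, and counting fixed points gives `p ∣ q ^ i - 1` with `q ^ i`
and `q ^ 2` dividing `|G|`.

A finite check then leaves the listed orders together with 810 and 1620, where one Hall subgroup has
order 81. An element of order 5 forces that subgroup to be abelian, which is already excluded. -/

/-! ### Arithmetic of π-numbers. -/

theorem IsPiNumber.of_dvd {π : Set Nat.Primes} {m n : ℕ} (hn : IsPiNumber π n) (h : m ∣ n) :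
    IsPiNumber π m := fun p hp => hn p (hp.trans h)

theorem IsPiNumber.mul {π : Set Nat.Primes} {m n : ℕ} (hm : IsPiNumber π m)
    (hn : IsPiNumber π n) : IsPiNumber π (m * n) := fun p hp =>
  (p.2.dvd_mul.1 hp).elim (hm p) (hn p)

theorem isPiNumber_one (π : Set Nat.Primes) : IsPiNumber π 1 := fun p hp =>
  absurd (Nat.dvd_one.1 hp) p.2.one_lt.ne'

theorem IsPiNumber.prime_pow {π : Set Nat.Primes} {p : Nat.Primes} (hp : p ∈ π) (k : ℕ) :
    IsPiNumber π ((p : ℕ) ^ k) := fun q hq => by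
  have h := (Nat.prime_dvd_prime_iff_eq q.2 p.2).1 (q.2.dvd_of_dvd_pow hq)
  rwa [Subtype.ext h]

theorem IsPiNumber.coprime {π : Set Nat.Primes} {m n : ℕ} (hm : IsPiNumber π m)
    (hn : IsPiNumber πᶜ n) : m.Coprime n :=
  Nat.coprime_of_dvd fun p hp h1 h2 => hn ⟨p, hp⟩ h2 (hm ⟨p, hp⟩ h1)

theorem IsPiNumber.eq_one {π : Set Nat.Primes} {m : ℕ} (hm : IsPiNumber π m)
    (hn : IsPiNumber πᶜ m) : m = 1 := (Nat.coprime_self m).1 (hm.coprime hn)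

/-! ### Conjugacy tools and Hall's theorem. -/

/-- A subgroup of a finite group which meets every conjugacy class is the whole group. -/
theorem Subgroup.eq_top_of_forall_exists_conj_mem {G : Type*} [Group G] [Finite G]
    {H : Subgroup G} (h : ∀ x : G, ∃ g : G, g⁻¹ * x * g ∈ H) : H = ⊤ := by
  classical
  have := Fintype.ofFinite G
  have := Fintype.ofFinite (G ⧸ H)
  -- Transitivity on cosets makes the average number of fixed cosets 1. Each element is conjugate
  -- into `H`, so it fixes at least one coset and hence exactly one. Applied to the identity, this
  -- gives index 1.
  have hburn := MulAction.sum_card_fixedBy_eq_card_orbits_mul_card_group G (G ⧸ H)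
  have horb : Fintype.card (Quotient (MulAction.orbitRel G (G ⧸ H))) = 1 := by
    rw [Fintype.card_eq_one_iff_nonempty_unique]
    exact (MulAction.pretransitive_iff_unique_quotient_of_nonempty G (G ⧸ H)).1 inferInstance
  rw [horb, one_mul] at hburn
  have hpos : ∀ g : G, 1 ≤ Fintype.card (MulAction.fixedBy (G ⧸ H) g) := fun x => by
    obtain ⟨g, hg⟩ := h x
    refine Fintype.card_pos_iff.2 ⟨⟨(g : G ⧸ H), ?_⟩⟩
    change ((x * g : G) : G ⧸ H) = g
    rw [eq_comm, QuotientGroup.eq]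
    simpa [mul_assoc] using hg
  have heq : ∀ g : G, Fintype.card (MulAction.fixedBy (G ⧸ H) g) = 1 := by
    by_contra! hne
    obtain ⟨g, hg⟩ := hne
    have : ∑ g : G, 1 < ∑ g : G, Fintype.card (MulAction.fixedBy (G ⧸ H) g) :=
      Finset.sum_lt_sum (fun i _ => hpos i) ⟨g, Finset.mem_univ _, lt_of_le_of_ne (hpos g) hg.symm⟩
    rw [hburn] at this
    simp at this
  have h1 := heq 1
  rw [← Subgroup.index_eq_one, Subgroup.index, ← h1, Nat.card_eq_fintype_card]
  exact Fintype.card_congr ((Equiv.subtypeUnivEquiv fun x => one_smul G x).symm)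

open MulAction in
open scoped Pointwise in
/-- Complements of an abelian normal Hall subgroup are conjugate. -/
theorem Subgroup.IsComplement'.exists_conj_mem {G : Type*} [Group G] [Finite G] {N H K : Subgroup G}
    [N.Normal] [IsMulCommutative N] (hN : (Nat.card N).Coprime N.index)
    (hH : N.IsComplement' H) (hK : N.IsComplement' K) :
    ∃ n ∈ N, ∀ k ∈ K, n⁻¹ * k * n ∈ H := by
  -- A complement is a transversal of `N` and stabilizes its own class in `N.QuotientDiff`;
  -- comparing orders, it is the whole stabilizer. Since `N` permutes these classes transitively,
  -- the stabilizers are conjugate.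
  let tr : ∀ L : Subgroup G, N.IsComplement' L → N.LeftTransversal := fun L hL =>
    ⟨(L : Set G), hL.symm⟩
  let q : N.LeftTransversal → N.QuotientDiff := fun T => Quotient.mk'' T
  have hst : ∀ (L : Subgroup G) (hL : N.IsComplement' L), L ≤ stabilizer G (q (tr L hL)) := by
    intro L hL l hl
    have : MulOpposite.op l⁻¹ • tr L hL = tr L hL := by
      apply Subtype.ext
      change MulOpposite.op l⁻¹ • (L : Set G) = L
      exact op_smul_coe_set (inv_mem hl)
    rw [mem_stabilizer_iff]
    change q (MulOpposite.op l⁻¹ • tr L hL) = q (tr L hL)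
    rw [this]
  have hEq : H = stabilizer G (q (tr H hH)) := by
    have hc := Subgroup.isComplement'_stabilizer_of_coprime (α := q (tr H hH)) hN
    refine Subgroup.eq_of_le_of_card_ge (hst H hH) ?_
    have h1 := hH.card_mul_card
    have h2 := hc.card_mul_card
    exact (Nat.eq_of_mul_eq_mul_left Nat.card_pos (h2.trans h1.symm)).le
  obtain ⟨n, hn⟩ := Subgroup.exists_smul_eq hN (q (tr H hH)) (q (tr K hK))
  refine ⟨n, n.2, fun k hk => ?_⟩
  rw [hEq, mem_stabilizer_iff, mul_smul, mul_smul, inv_smul_eq_iff]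
  have h3 : (n : G) • q (tr H hH) = q (tr K hK) := hn
  rw [h3]
  exact hst K hK hk

/-- A nontrivial finite soluble group has a nontrivial characteristic abelian `p`-subgroup. -/
theorem exists_characteristic_isPGroup (G : Type*) [Group G] [Finite G] [Group.IsSolvable G]
    [Nontrivial G] : ∃ (p : ℕ) (N : Subgroup G), p.Prime ∧ N.Characteristic ∧ N ≠ ⊥ ∧
      IsMulCommutative N ∧ IsPGroup p N := by
  classical
  have hs : ∃ n, derivedSeries G n = ⊥ := Group.IsSolvable.solvable
  have h0 : Nat.find hs ≠ 0 := by
    intro h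
    have := Nat.find_spec hs
    rw [h, derivedSeries_zero] at this
    exact top_ne_bot this
  -- The last nontrivial term of the derived series is abelian, so its Sylow subgroups are
  -- characteristic in it.
  obtain ⟨m, hm⟩ := Nat.exists_eq_succ_of_ne_zero h0
  let D := derivedSeries G m
  have hD : D ≠ ⊥ := Nat.find_min hs (by omega)
  have hDD : ⁅D, D⁆ = ⊥ := by
    have := Nat.find_spec hs
    rwa [hm, derivedSeries_succ] at this
  have hcomm : IsMulCommutative D := ⟨⟨fun x y => Subtype.ext <|
    (Subgroup.mem_centralizer_iff.1 (Subgroup.commutator_eq_bot_iff_le_centralizer.1 hDD x.2)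
      y y.2).symm⟩⟩
  have hchar : D.Characteristic := derivedSeries_characteristic G m
  obtain ⟨p, hp, hpd⟩ := Nat.exists_prime_and_dvd (n := Nat.card D)
    (by rw [Ne, Subgroup.card_eq_one]; exact hD)
  have := Fact.mk hp
  obtain ⟨S⟩ := (inferInstance : Nonempty (Sylow p D))
  have hSn : (S : Subgroup D).Normal := by
    constructor
    intro n hn g
    rwa [hcomm.1.comm g n, mul_inv_cancel_right]
  have hSc := S.characteristic_of_normal hSn
  refine ⟨p, (S : Subgroup D).map D.subtype, hp, ?_, ?_, ?_, S.2.map _⟩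
  · infer_instance
  · rw [Ne, Subgroup.map_eq_bot_iff_of_injective _ D.subtype_injective]
    exact S.ne_bot_of_dvd_card hpd
  · constructor
    constructor
    rintro ⟨_, x, hx, rfl⟩ ⟨_, y, hy, rfl⟩
    exact Subtype.ext (congrArg Subtype.val (hcomm.1.comm x y) :)

theorem IsHallSubgroup.card_mul_card {π : Set Nat.Primes} {G : Type*} [Group G] [Finite G]
    {A B : Subgroup G} (hA : IsHallSubgroup π A) (hB : IsHallSubgroup πᶜ B) :
    Nat.card A * Nat.card B = Nat.card G := by
  have h1 := A.card_mul_index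
  have h2 := B.card_mul_index
  have hB2 : IsPiNumber π B.index := by simpa using hB.2
  apply Nat.dvd_antisymm
  · exact (hA.1.coprime hB.1).mul_dvd_of_dvd_of_dvd A.card_subgroup_dvd_card
      B.card_subgroup_dvd_card
  · rw [← h1]
    refine mul_dvd_mul_left _ ?_
    refine ((hB2.coprime hA.2).symm).dvd_of_dvd_mul_right (n := B.index) ?_
    rw [h2]
    exact A.index_dvd_card

theorem IsHallSubgroup.of_card_mul_card {π : Set Nat.Primes} {G : Type*} [Group G] [Finite G]
    {A B : Subgroup G} (hA : IsPiNumber π (Nat.card A)) (hB : IsPiNumber πᶜ (Nat.card B))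
    (h : Nat.card A * Nat.card B = Nat.card G) : IsHallSubgroup π A ∧ IsHallSubgroup πᶜ B := by
  have h1 : A.index = Nat.card B := Nat.eq_of_mul_eq_mul_left Nat.card_pos
    (A.card_mul_index.trans h.symm)
  have h2 : B.index = Nat.card A := Nat.eq_of_mul_eq_mul_left Nat.card_pos
    (B.card_mul_index.trans (h.symm.trans (mul_comm _ _)))
  refine ⟨⟨hA, h1 ▸ hB⟩, hB, ?_⟩
  rw [compl_compl, h2]
  exact hA

theorem card_comap_mk' {G : Type*} [Group G] [Finite G] (N : Subgroup G) [N.Normal]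
    (K : Subgroup (G ⧸ N)) :
    Nat.card (K.comap (QuotientGroup.mk' N)) = Nat.card N * Nat.card K := by
  have h1 := (K.comap (QuotientGroup.mk' N)).card_mul_index
  rw [Subgroup.index_comap_of_surjective _ (QuotientGroup.mk'_surjective N)] at h1
  have h2 := K.card_mul_index
  have h3 := N.card_mul_index
  rw [Subgroup.index, ← h2] at h3
  have h4 : K.index ≠ 0 := Subgroup.index_ne_zero_of_finite
  apply Nat.eq_of_mul_eq_mul_right (Nat.pos_of_ne_zero h4)
  rw [h1, ← h3, mul_assoc]

/-- **Hall's theorem**, existence: a finite soluble group has Hall `π`-subgroups. -/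
theorem exists_isHallSubgroup (π : Set Nat.Primes) (G : Type*) [Group G] [Finite G]
    [Group.IsSolvable G] : ∃ H : Subgroup G, IsHallSubgroup π H := by
  induction hn : Nat.card G using Nat.strong_induction_on generalizing G with
  | _ n ih =>
  subst hn
  rcases subsingleton_or_nontrivial G with hG | hG
  · exact ⟨⊥, by simpa using isPiNumber_one π, by simpa using isPiNumber_one _⟩
  obtain ⟨p, N, hp, hNc, hN, -, hNp⟩ := exists_characteristic_isPGroup G
  have := Fact.mk hp
  have hNn : N.Normal := inferInstance
  obtain ⟨k, hk⟩ := IsPGroup.iff_card.1 hNp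
  have hN1 : 1 < Nat.card N := (Subgroup.one_lt_card_iff_ne_bot _).2 hN
  have hlt : Nat.card (G ⧸ N) < Nat.card G := by
    have := N.card_mul_index
    rw [← this, Subgroup.index]
    exact lt_mul_of_one_lt_left Nat.card_pos hN1
  obtain ⟨K, hK⟩ := ih _ hlt (G ⧸ N) rfl
  let H := K.comap (QuotientGroup.mk' N)
  have hHc : Nat.card H = Nat.card N * Nat.card K := card_comap_mk' N K
  have hHi : H.index = K.index :=
    Subgroup.index_comap_of_surjective _ (QuotientGroup.mk'_surjective N)
  by_cases hpπ : (⟨p, hp⟩ : Nat.Primes) ∈ π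
  · refine ⟨H, ?_, hHi ▸ hK.2⟩
    rw [hHc]
    exact IsPiNumber.mul (by rw [hk]; exact IsPiNumber.prime_pow (p := ⟨p, hp⟩) hpπ k) hK.1
  -- Now `N` is a normal Hall subgroup of `H`, and a Schur–Zassenhaus complement to it in `H` is the
  -- required subgroup.
  · have hNπ : IsPiNumber πᶜ (Nat.card N) := by
      rw [hk]; exact IsPiNumber.prime_pow (p := ⟨p, hp⟩) hpπ k
    have hNH : N ≤ H := QuotientGroup.le_comap_mk' N K
    have hc : Nat.card (N.subgroupOf H) = Nat.card N :=
      Nat.card_congr (Subgroup.subgroupOfEquivOfLe hNH).toEquiv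
    have hi : (N.subgroupOf H).index = Nat.card K := by
      have := (N.subgroupOf H).card_mul_index
      rw [hc, hHc] at this
      exact Nat.eq_of_mul_eq_mul_left Nat.card_pos this
    obtain ⟨L, hL⟩ := Subgroup.exists_right_complement'_of_coprime (N := N.subgroupOf H)
      (by rw [hc, hi]; exact (hK.1.coprime hNπ).symm)
    have hLc : Nat.card L = Nat.card K := by
      have := hL.card_mul_card
      rw [hc, hHc] at this
      exact Nat.eq_of_mul_eq_mul_left Nat.card_pos this
    have hLm : Nat.card (L.map H.subtype) = Nat.card K :=
      (Subgroup.card_map_of_injective H.subtype_injective).trans hLc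
    refine ⟨L.map H.subtype, hLm ▸ hK.1, ?_⟩
    have h1 := (L.map H.subtype).card_mul_index
    have h2 := H.card_mul_index
    rw [← h2, hLm, hHc, hHi, mul_comm (Nat.card N), mul_assoc] at h1
    rw [Nat.eq_of_mul_eq_mul_left Nat.card_pos h1]
    exact hNπ.mul hK.2

/-- If `A` is a Hall `π`-subgroup and `L ≥ A` is a `π`-group, then `L = A`. -/
theorem IsHallSubgroup.eq_of_le {π : Set Nat.Primes} {G : Type*} [Group G] [Finite G]
    {A L : Subgroup G} (hA : IsHallSubgroup π A) (hL : IsPiNumber π (Nat.card L)) (h : A ≤ L) :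
    L = A := by
  have h1 : A.relIndex L ∣ A.index := Dvd.intro _ (Subgroup.relIndex_mul_index h)
  have h2 : A.relIndex L ∣ Nat.card L := Subgroup.relIndex_dvd_card A L
  exact le_antisymm (Subgroup.relIndex_eq_one.1 ((hL.of_dvd h2).eq_one (hA.2.of_dvd h1))) h

/-- The quotient of the two sides is `|A ∩ N|`; divisibility is enough to see that `A ⊔ N` stays a
π-group when both factors are. -/
theorem card_sup_dvd_mul_card {G : Type*} [Group G] [Finite G] (A N : Subgroup G) [N.Normal] :
    Nat.card (A ⊔ N : Subgroup G) ∣ Nat.card A * Nat.card N := by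
  have h := Subgroup.relIndex_mul_relIndex ⊥ N (A ⊔ N) bot_le le_sup_right
  rw [Subgroup.relIndex_bot_left, Subgroup.relIndex_bot_left, Subgroup.relIndex_sup_right,
    mul_comm] at h
  rw [← h]
  exact mul_dvd_mul_right (Subgroup.relIndex_dvd_card N A) _

theorem Subgroup.exists_le_map_conj_iff {G : Type*} [Group G] (X A : Subgroup G) (g : G) :
    X.map (MulAut.conj g).toMonoidHom ≤ A ↔ ∀ x ∈ X, g * x * g⁻¹ ∈ A := by
  rw [Subgroup.map_le_iff_le_comap]
  rfl

/-- **Hall's theorem**: in a finite soluble group, every `π`-subgroup is conjugate to a subgroup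
of any given Hall `π`-subgroup. -/
theorem IsHallSubgroup.exists_map_conj_le {π : Set Nat.Primes} {G : Type*} [Group G] [Finite G]
    [Group.IsSolvable G] {A : Subgroup G} (hA : IsHallSubgroup π A) {X : Subgroup G}
    (hX : IsPiNumber π (Nat.card X)) : ∃ g : G, X.map (MulAut.conj g).toMonoidHom ≤ A := by
  induction hn : Nat.card G using Nat.strong_induction_on generalizing G with
  | _ n ih =>
  subst hn
  rcases subsingleton_or_nontrivial G with hG | hG
  · exact ⟨1, fun x _ => by rw [Subsingleton.elim x 1]; exact one_mem _⟩
  obtain ⟨p, N, hp, hNc, hN, hNa, hNp⟩ := exists_characteristic_isPGroup G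
  have := Fact.mk hp
  have hNn : N.Normal := inferInstance
  obtain ⟨k, hk⟩ := IsPGroup.iff_card.1 hNp
  have hN1 : 1 < Nat.card N := (Subgroup.one_lt_card_iff_ne_bot _).2 hN
  have hlt : Nat.card (G ⧸ N) < Nat.card G := by
    have := N.card_mul_index
    rw [← this, Subgroup.index]
    exact lt_mul_of_one_lt_left Nat.card_pos hN1
  let f := QuotientGroup.mk' N
  have hAf : IsHallSubgroup π (A.map f) :=
    ⟨hA.1.of_dvd (Subgroup.card_map_dvd _ f), hA.2.of_dvd
      (Subgroup.index_map_dvd _ (QuotientGroup.mk'_surjective N))⟩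
  obtain ⟨g', hg'⟩ := ih _ hlt hAf (X := X.map f) (hX.of_dvd (Subgroup.card_map_dvd _ f)) rfl
  obtain ⟨g, rfl⟩ := QuotientGroup.mk'_surjective N g'
  let Y := X.map (MulAut.conj g).toMonoidHom
  have hY : IsPiNumber π (Nat.card Y) := hX.of_dvd (Subgroup.card_map_dvd _ _)
  have hYA : Y ≤ A ⊔ N := by
    rintro _ ⟨x, hx, rfl⟩
    have : f (g * x * g⁻¹) ∈ A.map f := by
      rw [map_mul, map_mul, map_inv]
      exact (Subgroup.exists_le_map_conj_iff _ _ _).1 hg' _ (Subgroup.mem_map_of_mem f hx)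
    have h2 : g * x * g⁻¹ ∈ (A.map f).comap f := this
    rwa [Subgroup.comap_map_eq, QuotientGroup.ker_mk'] at h2
  suffices h : ∃ n : G, Y.map (MulAut.conj n).toMonoidHom ≤ A by
    obtain ⟨n, hn⟩ := h
    refine ⟨n * g, ?_⟩
    rw [Subgroup.exists_le_map_conj_iff] at hn ⊢
    intro x hx
    have := hn (g * x * g⁻¹) ⟨x, hx, rfl⟩
    simpa [mul_assoc] using this
  by_cases hpπ : (⟨p, hp⟩ : Nat.Primes) ∈ π
  · refine ⟨1, ?_⟩
    have hNπ : IsPiNumber π (Nat.card N) := by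
      rw [hk]; exact IsPiNumber.prime_pow (p := ⟨p, hp⟩) hpπ k
    rw [hA.eq_of_le ((hA.1.mul hNπ).of_dvd (card_sup_dvd_mul_card A N)) le_sup_left] at hYA
    rw [Subgroup.exists_le_map_conj_iff]
    intro x hx
    simpa using hYA hx
  · have hNπ : IsPiNumber πᶜ (Nat.card N) := by
      rw [hk]; exact IsPiNumber.prime_pow (p := ⟨p, hp⟩) hpπ k
    -- Both `Y` and `A ⊓ M` are complements to the abelian normal Hall subgroup `N` of `M`, hence
    -- conjugate in `M`.
    let M := Y ⊔ N
    have hNM : N ≤ M := le_sup_right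
    have hNMc : Nat.card (N.subgroupOf M) = Nat.card N :=
      Nat.card_congr (Subgroup.subgroupOfEquivOfLe hNM).toEquiv
    have key : ∀ Z : Subgroup G, Z ≤ M → M ≤ Z ⊔ N → IsPiNumber π (Nat.card Z) →
        (N.subgroupOf M).IsComplement' (Z.subgroupOf M) := by
      intro Z hZM hMZ hZ
      have hZc : Nat.card (Z.subgroupOf M) = Nat.card Z :=
        Nat.card_congr (Subgroup.subgroupOfEquivOfLe hZM).toEquiv
      refine Subgroup.isComplement'_of_coprime ?_ (by
        rw [hNMc, hZc]; exact (hZ.coprime hNπ).symm)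
      rw [hNMc, hZc]
      apply Nat.dvd_antisymm
      · exact (hZ.coprime hNπ).symm.mul_dvd_of_dvd_of_dvd (Subgroup.card_dvd_of_le hNM)
          (Subgroup.card_dvd_of_le hZM)
      · rw [mul_comm]
        exact (Subgroup.card_dvd_of_le hMZ).trans (card_sup_dvd_mul_card Z N)
    have hcY := key Y le_sup_left le_rfl hY
    have hMAN : M ≤ (A ⊓ M) ⊔ N := by
      intro x hx
      have hx' : x ∈ A ⊔ N := (sup_le hYA le_sup_right : M ≤ A ⊔ N) hx
      obtain ⟨a, ha, n, hn, rfl⟩ := Subgroup.mem_sup_of_normal_right.1 hx'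
      refine Subgroup.mul_mem_sup ⟨ha, ?_⟩ hn
      simpa using mul_mem hx (inv_mem (hNM hn))
    have hcA := key (A ⊓ M) inf_le_right hMAN
      (hA.1.of_dvd (Subgroup.card_dvd_of_le inf_le_left))
    have hab : IsMulCommutative (N.subgroupOf M) := inferInstance
    have hcop : (Nat.card (N.subgroupOf M)).Coprime (N.subgroupOf M).index := by
      have h1 := hcY.card_mul_card
      have h2 := (N.subgroupOf M).card_mul_index
      rw [Nat.eq_of_mul_eq_mul_left Nat.card_pos (h2.trans h1.symm), hNMc,
        Nat.card_congr (Subgroup.subgroupOfEquivOfLe (le_sup_left : Y ≤ M)).toEquiv]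
      exact (hY.coprime hNπ).symm
    obtain ⟨n, -, hn⟩ := hcA.exists_conj_mem hcop hcY
    refine ⟨(n : G)⁻¹, ?_⟩
    rw [Subgroup.exists_le_map_conj_iff]
    intro y hy
    have := hn ⟨y, (le_sup_left : Y ≤ M) hy⟩ hy
    rw [Subgroup.mem_subgroupOf] at this
    simpa using this.1

/-- A normal `π`-subgroup is contained in every Hall `π`-subgroup. -/
theorem IsHallSubgroup.normal_le {π : Set Nat.Primes} {G : Type*} [Group G] [Finite G]
    {A : Subgroup G} (hA : IsHallSubgroup π A) {N : Subgroup G} [N.Normal]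
    (hN : IsPiNumber π (Nat.card N)) : N ≤ A := by
  rw [← hA.eq_of_le ((hA.1.mul hN).of_dvd (card_sup_dvd_mul_card A N)) le_sup_left]
  exact le_sup_right

/-- A normal subgroup is the product of its intersections with complementary Hall subgroups. -/
theorem IsHallSubgroup.card_inf_mul_card_inf {π : Set Nat.Primes} {G : Type*} [Group G] [Finite G]
    {A B : Subgroup G} (hA : IsHallSubgroup π A) (hB : IsHallSubgroup πᶜ B) (K : Subgroup G)
    [K.Normal] : Nat.card (A ⊓ K : Subgroup G) * Nat.card (B ⊓ K : Subgroup G) = Nat.card K := by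
  have key : ∀ (ρ : Set Nat.Primes) (C : Subgroup G), IsHallSubgroup ρ C →
      IsHallSubgroup ρ (C.subgroupOf K) ∧
        Nat.card (C.subgroupOf K) = Nat.card (C ⊓ K : Subgroup G) := by
    intro ρ C hC
    have hc : Nat.card (C.subgroupOf K) = Nat.card (C ⊓ K : Subgroup G) := by
      rw [← Subgroup.inf_subgroupOf_right]
      exact Nat.card_congr (Subgroup.subgroupOfEquivOfLe inf_le_right).toEquiv
    refine ⟨⟨hc ▸ hC.1.of_dvd (Subgroup.card_dvd_of_le inf_le_left), ?_⟩, hc⟩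
    refine hC.2.of_dvd ?_
    have h1 : C.relIndex (K ⊔ C) ∣ C.index := Dvd.intro _ (Subgroup.relIndex_mul_index le_sup_right)
    have h2 := Subgroup.relIndex_mul_relIndex ⊥ C (K ⊔ C) bot_le le_sup_right
    have h3 := Subgroup.relIndex_mul_relIndex ⊥ K (K ⊔ C) bot_le le_sup_left
    have h4 := Subgroup.relIndex_mul_relIndex ⊥ (C ⊓ K) K bot_le inf_le_right
    have h5 := Subgroup.relIndex_mul_relIndex ⊥ (C ⊓ K) C bot_le inf_le_left
    have h6 : K.relIndex (K ⊔ C) = K.relIndex C := by rw [sup_comm, Subgroup.relIndex_sup_right]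
    simp only [Subgroup.relIndex_bot_left, Subgroup.inf_relIndex_right,
      Subgroup.inf_relIndex_left] at h2 h3 h4 h5
    -- The product formula for `KC` turns the index of `C ∩ K` in `K` into that of `C` in `KC`, a
    -- divisor of the index of `C` in `G`.
    suffices h : C.relIndex (K ⊔ C) = C.relIndex K by
      rw [h] at h1
      exact h1
    apply Nat.eq_of_mul_eq_mul_left (Nat.card_pos (α := C))
    rw [h2, ← h3, h6, ← h4, ← h5]
    ring
  obtain ⟨h1, h2⟩ := key π A hA
  obtain ⟨h3, h4⟩ := key πᶜ B hB
  rw [← h2, ← h4]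
  exact h1.card_mul_card h3

/-! ### Class numbers and the comparison with Hall subgroups. -/

theorem ccl_congr {G H : Type*} [Group G] [Group H] (e : G ≃* H) : ccl G = ccl H := by
  refine Nat.card_congr (Equiv.ofBijective (ConjClasses.map e.toMonoidHom) ⟨?_, ?_⟩)
  · intro x y
    obtain ⟨a, rfl⟩ := ConjClasses.exists_rep x
    obtain ⟨b, rfl⟩ := ConjClasses.exists_rep y
    intro h
    have h' : IsConj (e a) (e b) := ConjClasses.mk_eq_mk_iff_isConj.1 h
    rw [ConjClasses.mk_eq_mk_iff_isConj]
    obtain ⟨c, hc⟩ := isConj_iff.1 h'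
    exact isConj_iff.2 ⟨e.symm c, e.injective (by simpa using hc)⟩
  · exact ConjClasses.map_surjective e.surjective

theorem ccl_pos (G : Type*) [Group G] [Finite G] : 0 < ccl G := Nat.card_pos

theorem ccl_le_card (G : Type*) [Group G] [Finite G] : ccl G ≤ Nat.card G :=
  Nat.card_le_card_of_surjective ConjClasses.mk ConjClasses.mk_surjective

/-- The π-part and π'-part of `g`, obtained by splitting the cyclic group generated by `g` into its
Hall subgroups. -/
theorem exists_mul_eq_of_isPiNumber (π : Set Nat.Primes) {G : Type*} [Group G] [Finite G] (g : G) :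
    ∃ a b : G, Commute a b ∧ a * b = g ∧ IsPiNumber π (Nat.card (Subgroup.zpowers a)) ∧
      IsPiNumber πᶜ (Nat.card (Subgroup.zpowers b)) := by
  obtain ⟨C, hCdef⟩ : ∃ C : Subgroup G, C = Subgroup.zpowers g := ⟨_, rfl⟩
  have hgC : g ∈ C := hCdef ▸ Subgroup.mem_zpowers g
  have hcomm : ∀ a b : C, a * b = b * a := by
    subst hCdef
    rintro ⟨_, m, rfl⟩ ⟨_, n, rfl⟩
    exact Subtype.ext (((Commute.refl g).zpow_zpow m n).eq)
  have hC : Group.IsSolvable C := Group.isSolvable_of_comm hcomm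
  obtain ⟨H, hH⟩ := exists_isHallSubgroup π C
  obtain ⟨K, hK⟩ := exists_isHallSubgroup πᶜ C
  have hc : H.IsComplement' K :=
    Subgroup.isComplement'_of_coprime (hH.card_mul_card hK) (hH.1.coprime hK.1)
  obtain ⟨⟨⟨a, ha⟩, ⟨b, hb⟩⟩, hab⟩ := hc.2 ⟨g, hgC⟩
  have key : ∀ (L : Subgroup C) (x : C), x ∈ L →
      Nat.card (Subgroup.zpowers (x : G)) ∣ Nat.card L := by
    intro L x hx
    rw [Nat.card_zpowers, Subgroup.orderOf_coe, ← Nat.card_zpowers]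
    exact Subgroup.card_dvd_of_le ((Subgroup.zpowers_le).2 hx)
  exact ⟨a, b, congrArg Subtype.val (hcomm a b), congrArg Subtype.val hab,
    hH.1.of_dvd (key H a ha), hK.1.of_dvd (key K b hb)⟩

/-- Commuting complementary Hall subgroups give a direct decomposition. -/
theorem nonempty_mulEquiv_prod_of_commute {π : Set Nat.Primes} {G : Type*} [Group G] [Finite G]
    {A B : Subgroup G} (hA : IsHallSubgroup π A) (hB : IsHallSubgroup πᶜ B)
    (h : ∀ a ∈ A, ∀ b ∈ B, Commute a b) : Nonempty (G ≃* A × B) := by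
  have hc : A.IsComplement' B :=
    Subgroup.isComplement'_of_coprime (hA.card_mul_card hB) (hA.1.coprime hB.1)
  refine ⟨(MulEquiv.ofBijective
    (MonoidHom.noncommCoprod A.subtype B.subtype fun a b => h a a.2 b b.2) ?_).symm⟩
  exact hc

/-- If every proper subgroup of the Hall `π`-subgroup `A` has fewer conjugacy classes than `A`,
then a finite soluble group satisfies the conclusion of `Con*_π`. -/
theorem IsHallSubgroup.ccl_lt_or_of_forall_ccl_lt {π : Set Nat.Primes} {G : Type*} [Group G]
    [Finite G] [Group.IsSolvable G] {A B : Subgroup G} (hA : IsHallSubgroup π A)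
    (hB : IsHallSubgroup πᶜ B) (hlt : ∀ H : Subgroup A, H ≠ ⊤ → ccl H < ccl A) :
    ccl G < ccl A * ccl B ∨ Nonempty (G ≃* A × B) := by
  choose hall hhall using fun b : G => exists_isHallSubgroup π (Subgroup.centralizer {b})
  let loc : G → Subgroup G := fun b => (hall b).map (Subgroup.centralizer {b}).subtype
  have hlocpi : ∀ b, IsPiNumber π (Nat.card (loc b)) := fun b =>
    (hhall b).1.of_dvd (Subgroup.card_map_dvd _ _)
  have hloccomm : ∀ b, ∀ x ∈ loc b, Commute x b := by
    rintro b _ ⟨x, -, rfl⟩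
    exact Subgroup.mem_centralizer_singleton_iff.1 x.2
  have hloc : ∀ b, ccl (loc b) < ccl A ∨
      (ccl (loc b) = ccl A ∧ ∃ g : G, ∀ a ∈ A, Commute (g * a * g⁻¹) b) := by
    intro b
    obtain ⟨g, hg⟩ := hA.exists_map_conj_le (hlocpi b)
    let X := (loc b).map (MulAut.conj g).toMonoidHom
    have h1 : ccl (loc b) = ccl X :=
      ccl_congr ((loc b).equivMapOfInjective _ (MulAut.conj g).injective)
    have h2 : ccl X = ccl (X.subgroupOf A) := ccl_congr (Subgroup.subgroupOfEquivOfLe hg).symm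
    by_cases hX : X.subgroupOf A = ⊤
    · right
      have hXA : X = A := le_antisymm hg (Subgroup.subgroupOf_eq_top.1 hX)
      refine ⟨by rw [h1, hXA], g⁻¹, fun a ha => ?_⟩
      rw [← hXA] at ha
      obtain ⟨x, hx, rfl⟩ := ha
      have := hloccomm b x hx
      simpa [mul_assoc] using this
    · left
      rw [h1, h2]
      exact hlt _ hX
  choose rep hrep using fun β : ConjClasses B => ConjClasses.exists_rep β
  choose rep' hrep' using fun (β : ConjClasses B) (α : ConjClasses (loc (rep β))) =>
    ConjClasses.exists_rep α
  let F : (Σ β : ConjClasses B, ConjClasses (loc (rep β))) → ConjClasses G := fun x =>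
    ConjClasses.mk ((rep' x.1 x.2 : G) * (rep x.1 : G))
  have hF : Function.Surjective F := by
    intro x
    obtain ⟨g, rfl⟩ := ConjClasses.exists_rep x
    -- Conjugate the π'-part to the chosen representative `b₀`. The π-part then lies in the
    -- centralizer of `b₀`, where it can be moved into `loc b₀` and on to its representative; these
    -- last conjugations fix `b₀`.
    obtain ⟨a, b, hab, rfl, ha, hb⟩ := exists_mul_eq_of_isPiNumber π g
    obtain ⟨x, hx⟩ := hB.exists_map_conj_le hb
    have hxb : x * b * x⁻¹ ∈ B :=
      (Subgroup.exists_le_map_conj_iff _ _ _).1 hx b (Subgroup.mem_zpowers b)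
    let β : ConjClasses B := ConjClasses.mk ⟨_, hxb⟩
    obtain ⟨y, hy⟩ := isConj_iff.1 (ConjClasses.mk_eq_mk_iff_isConj.1 (hrep β).symm)
    have hy' : (y * x) * b * (y * x)⁻¹ = (rep β : G) := by
      rw [← hy]; simp [mul_assoc]
    set b₀ : G := ((rep β : B) : G)
    set z : G := y * x
    have hzc : z * a * z⁻¹ ∈ Subgroup.centralizer {b₀} := by
      rw [Subgroup.mem_centralizer_singleton_iff, ← hy']
      have : z * (a * b) * z⁻¹ = z * (b * a) * z⁻¹ := by rw [hab.eq]
      simpa [mul_assoc] using this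
    obtain ⟨c, hc⟩ := (hhall b₀).exists_map_conj_le
      (X := Subgroup.zpowers (⟨_, hzc⟩ : Subgroup.centralizer {b₀})) (by
        rw [Nat.card_zpowers, ← Subgroup.orderOf_coe]
        change IsPiNumber π (orderOf (MulAut.conj z a))
        rw [MulEquiv.orderOf_eq, ← Nat.card_zpowers]
        exact ha)
    have hca := (Subgroup.exists_le_map_conj_iff _ _ _).1 hc _ (Subgroup.mem_zpowers _)
    let a₂ : loc b₀ := ⟨_, Subgroup.mem_map_of_mem _ hca⟩
    let α : ConjClasses (loc (rep β)) := ConjClasses.mk a₂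
    obtain ⟨w, hw⟩ := isConj_iff.1 (ConjClasses.mk_eq_mk_iff_isConj.1 (hrep' β α).symm)
    refine ⟨⟨β, α⟩, ?_⟩
    change ConjClasses.mk ((rep' β α : G) * b₀) = _
    rw [eq_comm, ConjClasses.mk_eq_mk_iff_isConj, isConj_iff]
    refine ⟨(w : G) * (c : G) * z, ?_⟩
    have hwc : Commute ((w : G) * (c : G)) b₀ :=
      (hloccomm b₀ w w.2).mul_left (Subgroup.mem_centralizer_singleton_iff.1 c.2)
    have hb₀ : ((w : G) * (c : G)) * b₀ * ((w : G) * (c : G))⁻¹ = b₀ := by rw [hwc.eq, mul_inv_cancel_right]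
    calc ((w : G) * (c : G) * z) * (a * b) * ((w : G) * (c : G) * z)⁻¹
        = ((w : G) * ((c : G) * (z * a * z⁻¹) * (c : G)⁻¹) * (w : G)⁻¹) *
            (((w : G) * (c : G)) * (z * b * z⁻¹) * ((w : G) * (c : G))⁻¹) := by group
      _ = (rep' β α : G) * b₀ := by rw [hy', hb₀, ← hw]; rfl
  have hle : ccl G ≤ ∑ᶠ β : ConjClasses B, ccl (loc (rep β)) := by
    have := Fintype.ofFinite (ConjClasses B)
    rw [finsum_eq_sum_of_fintype]
    refine (Nat.card_le_card_of_surjective F hF).trans ?_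
    rw [Nat.card_sigma]
    rfl
  have := Fintype.ofFinite (ConjClasses B)
  rw [finsum_eq_sum_of_fintype] at hle
  have hsum : ∑ _β : ConjClasses B, ccl A = ccl A * ccl B := by
    rw [Finset.sum_const, Finset.card_univ, smul_eq_mul, mul_comm, ccl, ccl,
      Nat.card_eq_fintype_card (α := ConjClasses B)]
  have hle' : ∀ β : ConjClasses B, ccl (loc (rep β)) ≤ ccl A := fun β =>
    (hloc _).elim le_of_lt fun h => h.1.le
  by_cases hall_eq : ∀ β : ConjClasses B, ∃ g : G, ∀ a ∈ A, Commute (g * a * g⁻¹) (rep β)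
  · right
    refine nonempty_mulEquiv_prod_of_commute hA hB ?_
    have hBA : B.IsComplement' A := (Subgroup.isComplement'_of_coprime (hA.card_mul_card hB)
      (hA.1.coprime hB.1)).symm
    have htop : (Subgroup.centralizer (A : Set G)).subgroupOf B = ⊤ := by
      apply Subgroup.eq_top_of_forall_exists_conj_mem
      intro b
      obtain ⟨g, hg⟩ := hall_eq (ConjClasses.mk b)
      obtain ⟨y, hy⟩ := isConj_iff.1 (ConjClasses.mk_eq_mk_iff_isConj.1
        (hrep (ConjClasses.mk b)).symm)
      -- Split the conjugator along `G = BA`. The factor in `A` normalizes `A` and can be discarded,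
      -- so an element of `B` alone conjugates `b` into the centralizer of `A`.
      have hyg : ∃ b' : B, ∃ a' : A, (b' : G) * a' = (y : G)⁻¹ * g := by
        obtain ⟨⟨b', a'⟩, h⟩ := hBA.2 ((y : G)⁻¹ * g)
        exact ⟨b', a', h⟩
      obtain ⟨b', a', h'⟩ := hyg
      refine ⟨b', ?_⟩
      rw [Subgroup.mem_subgroupOf, Subgroup.mem_centralizer_iff]
      intro a ha
      have h1 := hg (a'⁻¹ * a * a') (mul_mem (mul_mem (inv_mem a'.2) ha) a'.2)
      rw [← hy] at h1
      have h2 : g = y * (b' * a') := by rw [h']; group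
      rw [h2] at h1
      have h3 := h1.map (MulAut.conj ((y * b' : G)⁻¹)).toMonoidHom
      have h4 := h3.eq
      simpa [mul_assoc] using h4
    intro a ha b hb
    have : (⟨b, hb⟩ : B) ∈ (Subgroup.centralizer (A : Set G)).subgroupOf B := by
      rw [htop]; exact Subgroup.mem_top _
    rw [Subgroup.mem_subgroupOf] at this
    exact Subgroup.mem_centralizer_iff.1 this a ha
  · left
    push Not at hall_eq
    obtain ⟨β, hβ⟩ := hall_eq
    rw [← hsum]
    refine hle.trans_lt (Finset.sum_lt_sum (fun β _ => hle' β) ⟨β, Finset.mem_univ _, ?_⟩)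
    refine (hloc _).resolve_right fun h => ?_
    obtain ⟨g, hg⟩ := h.2
    obtain ⟨a, ha, hna⟩ := hβ g
    exact hna (hg a ha)

/-! ### Orders for which every proper subgroup has fewer classes. -/

theorem Subgroup.card_lt_card_of_ne_top {G : Type*} [Group G] [Finite G] {H : Subgroup G}
    (h : H ≠ ⊤) : Nat.card H < Nat.card G := by
  refine lt_of_le_of_ne H.card_le_card_group fun h' => h ?_
  exact Subgroup.eq_top_of_card_eq H h'

theorem ccl_lt_of_ne_top_of_comm {G : Type*} [Group G] [Finite G] (hG : ∀ a b : G, a * b = b * a)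
    (H : Subgroup G) (hH : H ≠ ⊤) : ccl H < ccl G := by
  refine (ccl_le_card H).trans_lt ((Subgroup.card_lt_card_of_ne_top hH).trans_le ?_)
  refine Nat.card_le_card_of_injective ConjClasses.mk fun a b hab => ?_
  obtain ⟨c, hc⟩ := isConj_iff.1 (ConjClasses.mk_eq_mk_iff_isConj.1 hab)
  rw [← hc, hG c a, mul_inv_cancel_right]

/-- Both sides count commuting pairs. -/
theorem sum_card_centralizer (G : Type*) [Group G] [Fintype G] :
    ∑ x : G, Nat.card (Subgroup.centralizer {x}) = ccl G * Nat.card G := by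
  rw [ccl, ← card_comm_eq_card_conjClasses_mul_card, ← Nat.card_sigma]
  refine Nat.card_congr ⟨fun x => ⟨(x.1, x.2), ?_⟩, fun x => ⟨x.1.1, x.1.2, ?_⟩,
    fun _ => rfl, fun _ => rfl⟩
  · exact (Subgroup.mem_centralizer_singleton_iff.1 x.2.2).symm
  · exact Subgroup.mem_centralizer_singleton_iff.2 x.2.eq.symm

/-- A proper subgroup has at most `p ^ 2` elements, so it suffices that `G` has more than `p ^ 2`
classes. Every centralizer has order at least `p ^ 2`: one of order `p` would equal the nontrivial
center, making its element central and the centralizer all of `G`. The centralizer of 1 makes the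
average order exceed `p ^ 2`. -/
theorem ccl_lt_of_ne_top_of_card_eq_prime_pow_three {G : Type*} [Group G] {p : ℕ} (hp : p.Prime)
    (hG : Nat.card G = p ^ 3) (H : Subgroup G) (hH : H ≠ ⊤) : ccl H < ccl G := by
  have := Fact.mk hp
  have : Finite G := Nat.finite_of_card_ne_zero (by rw [hG]; exact (pow_pos hp.pos 3).ne')
  have hpow : ∀ K : Subgroup G, ∃ k ≤ 3, Nat.card K = p ^ k := fun K =>
    (Nat.dvd_prime_pow hp).1 (hG ▸ K.card_subgroup_dvd_card)
  have hHc : Nat.card H ≤ p ^ 2 := by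
    obtain ⟨k, hk, hHk⟩ := hpow H
    have hlt := Subgroup.card_lt_card_of_ne_top hH
    rw [hHk, hG] at hlt
    rw [hHk]
    exact Nat.pow_le_pow_right hp.pos (Nat.lt_succ_iff.1 ((Nat.pow_lt_pow_iff_right hp.one_lt).1 hlt))
  refine ((ccl_le_card H).trans hHc).trans_lt ?_
  have hnt : Nontrivial G := Finite.one_lt_card_iff_nontrivial.1
    (by rw [hG]; exact Nat.one_lt_pow (by norm_num) hp.one_lt)
  have hcent : ∀ x : G, p ^ 2 ≤ Nat.card (Subgroup.centralizer {x}) := by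
    intro x
    have hZ : Subgroup.center G ≤ Subgroup.centralizer {x} := Subgroup.center_le_centralizer _
    have hZ1 : 1 < Nat.card (Subgroup.center G) := by
      have := (IsPGroup.of_card hG).center_nontrivial
      exact Finite.one_lt_card
    obtain ⟨k, -, hk⟩ := hpow (Subgroup.centralizer {x})
    obtain ⟨j, -, hj⟩ := hpow (Subgroup.center G)
    rw [hk]
    refine Nat.pow_le_pow_right hp.pos ?_
    by_contra! hk2
    have hj0 : j ≠ 0 := by rintro rfl; rw [hj] at hZ1; simp at hZ1
    have hjk : j ≤ k := by
      have := Subgroup.card_le_of_le hZ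
      rw [hj, hk] at this
      exact (Nat.pow_le_pow_iff_right hp.one_lt).1 this
    have hEq : Subgroup.center G = Subgroup.centralizer {x} := by
      apply Subgroup.eq_of_le_of_card_ge hZ
      rw [hj, hk]
      exact Nat.pow_le_pow_right hp.pos (by omega)
    have hxc : x ∈ Subgroup.center G := by
      rw [hEq, Subgroup.mem_centralizer_singleton_iff]
    have htop : Subgroup.centralizer {x} = ⊤ := by
      rw [eq_top_iff]
      intro y _
      rw [Subgroup.mem_centralizer_singleton_iff]
      exact (Subgroup.mem_center_iff.1 hxc y)
    rw [htop, Subgroup.card_top, hG] at hk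
    have := Nat.pow_right_injective hp.two_le hk
    omega
  have := Fintype.ofFinite G
  have hsum := sum_card_centralizer G
  have hlt : ∑ _x : G, p ^ 2 < ∑ x : G, Nat.card (Subgroup.centralizer {x}) := by
    refine Finset.sum_lt_sum (fun x _ => hcent x) ⟨1, Finset.mem_univ _, ?_⟩
    have : Subgroup.centralizer {(1 : G)} = ⊤ := by
      rw [eq_top_iff]
      intro y _
      rw [Subgroup.mem_centralizer_singleton_iff, mul_one, one_mul]
    rw [this, Subgroup.card_top, hG]
    exact Nat.pow_lt_pow_right hp.one_lt (by norm_num)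
  rw [hsum, Finset.sum_const, Finset.card_univ, ← Nat.card_eq_fintype_card, smul_eq_mul,
    mul_comm] at hlt
  exact Nat.lt_of_mul_lt_mul_right hlt

/-- A finite group whose Sylow subgroups are all normal and of order `1`, `p` or `p ^ 2` is
abelian. -/
theorem mul_comm_of_sylow {G : Type*} [Group G] [Finite G]
    (h : ∀ p : ℕ, p.Prime → Nat.card (Sylow p G) = 1 ∧ (Nat.card G).factorization p ≤ 2) (a b : G) :
    a * b = b * a := by
  have h1 : ∀ (p : ℕ) (_ : Fact p.Prime) (P : Sylow p G), (P : Subgroup G).Normal := by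
    intro p hp P
    have : Subsingleton (Sylow p G) := (Nat.card_eq_one_iff_unique.1 (h p hp.out).1).1
    exact P.normal_of_subsingleton
  obtain ⟨e⟩ := ((Group.isNilpotent_of_finite_tfae (G := G)).out 3 4).1 h1
  suffices hc : ∀ x y : (p : (Nat.card G).primeFactors) → (P : Sylow p G) → P, x * y = y * x by
    apply e.symm.injective
    rw [map_mul, map_mul, hc]
  intro x y
  funext p P
  have hp := Nat.prime_of_mem_primeFactors p.2
  have := Fact.mk hp
  have hcard := P.card_eq_multiplicity
  have hle := (h p hp).2
  change x p P * y p P = y p P * x p P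
  rcases Nat.le_succ_iff.1 hle with h1 | h2
  · have hcyc : IsCyclic P := by
      rcases Nat.le_one_iff_eq_zero_or_eq_one.1 h1 with h0 | h0
      · rw [h0, pow_zero] at hcard
        have := (Nat.card_eq_one_iff_unique.1 hcard).1
        infer_instance
      · rw [h0, pow_one] at hcard
        exact isCyclic_of_prime_card hcard
    exact Std.Commutative.comm _ _
  · rw [h2] at hcard
    have := IsPGroup.isMulCommutative_of_card_eq_prime_sq hcard
    exact Std.Commutative.comm _ _

/-- Sylow's congruence and divisibility conditions leave one Sylow subgroup per prime, and no prime
cube divides these orders. -/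
theorem mul_comm_of_card_eq {G : Type*} [Group G] (hG : Nat.card G = 15 ∨ Nat.card G = 35 ∨
    Nat.card G = 45) (a b : G) : a * b = b * a := by
  have hfin : Finite G := Nat.finite_of_card_ne_zero (by omega)
  refine mul_comm_of_sylow (fun p hp => ?_) a b
  have := Fact.mk hp
  obtain ⟨P⟩ := (inferInstance : Nonempty (Sylow p G))
  have hmod := card_sylow_modEq_one p G
  have hdvd : Nat.card (Sylow p G) ∣ Nat.card G :=
    P.card_dvd_index.trans (Subgroup.index_dvd_card _)
  have hcop : Nat.card (Sylow p G) % p ≠ 0 := by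
    rw [hmod, Nat.mod_eq_of_lt hp.one_lt]
    exact one_ne_zero
  constructor
  · by_cases hpG : p ∣ Nat.card G
    · have hp' : p = 3 ∨ p = 5 ∨ p = 7 := by
        have hle := Nat.le_of_dvd Nat.card_pos hpG
        rcases hG with h | h | h <;> rw [h] at hpG hle <;> interval_cases p <;> revert hp hpG <;> decide
      have hle := Nat.le_of_dvd Nat.card_pos hdvd
      generalize Nat.card (Sylow p G) = s at *
      have hmod' : s % p = 1 % p := hmod
      rcases hG with h | h | h <;> rw [h] at hdvd hle hpG <;> rcases hp' with rfl | rfl | rfl <;>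
        interval_cases s <;> revert hdvd hmod' hpG <;> decide
    · have := (P.card_eq_multiplicity)
      rw [Nat.factorization_eq_zero_of_not_dvd hpG, pow_zero, Subgroup.card_eq_one] at this
      have hi := P.card_dvd_index
      have hP : (P : Subgroup G).Normal := by rw [this]; infer_instance
      have := P.unique_of_normal hP
      exact Nat.card_unique
  · by_contra! hlt
    have h3 : p ^ 3 ∣ Nat.card G := (hp.pow_dvd_iff_le_factorization Nat.card_pos.ne').2 hlt
    have hle : p ^ 3 ≤ 45 := (Nat.le_of_dvd Nat.card_pos h3).trans (by omega)
    have hp4 : p < 4 := by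
      by_contra! h4
      have := Nat.pow_le_pow_left h4 3
      omega
    rcases hG with h | h | h <;> rw [h] at h3 <;> interval_cases p <;> revert hp h3 <;> decide

/-! ### Commuting pairs in a split extension of a group of prime order. -/

/-- The number of ordered pairs of commuting elements of a subgroup. -/
noncomputable def commPairs {G : Type*} [Group G] (S : Subgroup G) : ℕ :=
  Nat.card {x : S × S // Commute x.1 x.2}

theorem commPairs_eq {G : Type*} [Group G] (S : Subgroup G) :
    commPairs S = ccl S * Nat.card S := card_comm_eq_card_conjClasses_mul_card S

theorem commPairs_pos {G : Type*} [Group G] [Finite G] (S : Subgroup G) : 0 < commPairs S := by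
  rw [commPairs_eq]
  exact Nat.mul_pos (ccl_pos S) Nat.card_pos

/-- The advantage of commuting pairs over class numbers: strict monotonicity in the subgroup. -/
theorem commPairs_lt {G : Type*} [Group G] [Finite G] {S T : Subgroup G} (h : S < T) :
    commPairs S < commPairs T := by
  obtain ⟨hle, x, hxT, hxS⟩ := SetLike.lt_iff_le_and_exists.1 h
  let f : {x : S × S // Commute x.1 x.2} → {x : T × T // Commute x.1 x.2} := fun y =>
    ⟨(⟨y.1.1, hle y.1.1.2⟩, ⟨y.1.2, hle y.1.2.2⟩),
      Subtype.ext (congrArg Subtype.val y.2.eq :)⟩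
  have hf : Function.Injective f := by
    rintro ⟨⟨⟨a, ha⟩, b, hb⟩, h1⟩ ⟨⟨⟨c, hc⟩, d, hd⟩, h2⟩ hac
    have e1 : a = c := congrArg (fun z => (z.1.1 : G)) hac
    have e2 : b = d := congrArg (fun z => (z.1.2 : G)) hac
    subst e1 e2
    rfl
  have := Fintype.ofFinite {x : S × S // Commute x.1 x.2}
  have := Fintype.ofFinite {x : T × T // Commute x.1 x.2}
  rw [commPairs, commPairs, Nat.card_eq_fintype_card, Nat.card_eq_fintype_card]
  refine Fintype.card_lt_of_injective_of_notMem f hf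
    (b := ⟨(⟨x, hxT⟩, ⟨x, hxT⟩), Commute.refl _⟩) ?_
  rintro ⟨y, hy⟩
  have h1 : (y.1.1 : G) = x := congrArg (fun z => (z.1.1 : G)) hy
  exact hxS (h1 ▸ y.1.1.2)

theorem card_fiber_product {X Y Z : Type*} [Finite X] [Finite Y] (f : X → Z) (g : Y → Z)
    (hf : Function.Bijective f) : Nat.card {x : X × Y // f x.1 = g x.2} = Nat.card Y := by
  refine Nat.card_congr (Equiv.ofBijective (fun x => x.1.2) ⟨?_, fun y => ?_⟩)
  · rintro ⟨⟨a, b⟩, h1⟩ ⟨⟨c, d⟩, h2⟩ (rfl : b = d)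
    have : a = c := hf.1 (h1.trans h2.symm)
    subst this
    rfl
  · obtain ⟨x, hx⟩ := hf.2 (g y)
    exact ⟨⟨(x, y), hx⟩, rfl⟩

theorem mul_comm_of_prime_card {G : Type*} [Group G] {p : ℕ} (hp : p.Prime) {P : Subgroup G}
    (hP : Nat.card P = p) {x y : G} (hx : x ∈ P) (hy : y ∈ P) : x * y = y * x := by
  have := Fact.mk hp
  have : IsCyclic P := isCyclic_of_prime_card hP
  have h : (⟨x, hx⟩ : P) * ⟨y, hy⟩ = ⟨y, hy⟩ * ⟨x, hx⟩ := Std.Commutative.comm _ _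
  exact congrArg Subtype.val h

/-- The map `v ↦ v⁻¹ * (l * v * l⁻¹)` on a normal subgroup. -/
def commutatorMap {G : Type*} [Group G] (P : Subgroup G) [P.Normal] (l : G) (v : P) : P :=
  ⟨(v : G)⁻¹ * (l * v * l⁻¹), P.mul_mem (P.inv_mem v.2) (Subgroup.Normal.conj_mem ‹_› _ v.2 l)⟩

/-- Two arguments with the same value differ by an element of `P` commuting with `l`. Such elements
form a subgroup of a group of prime order, and it is proper, hence trivial. -/
theorem commutatorMap_bijective {G : Type*} [Group G] {p : ℕ} (hp : p.Prime) {P : Subgroup G}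
    [P.Normal] (hP : Nat.card P = p) {l : G} (hl : l ∉ Subgroup.centralizer (P : Set G)) :
    Function.Bijective (commutatorMap P l) := by
  have := Fact.mk hp
  have : Finite P := Nat.finite_of_card_ne_zero (by rw [hP]; exact hp.ne_zero)
  refine Function.Injective.bijective_of_finite ?_
  intro v w hvw
  have hvw' : (v : G)⁻¹ * (l * v * l⁻¹) = (w : G)⁻¹ * (l * w * l⁻¹) := congrArg Subtype.val hvw
  have hfix : (w * (v : G)⁻¹) * l = l * (w * (v : G)⁻¹) := by
    have h1 : (w : G) * (v : G)⁻¹ = (v : G)⁻¹ * w :=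
      mul_comm_of_prime_card hp hP w.2 (inv_mem v.2)
    have h2 : (w : G) * ((v : G)⁻¹ * (l * v * l⁻¹)) = l * w * l⁻¹ := by
      rw [hvw', mul_inv_cancel_left]
    calc (w * (v : G)⁻¹) * l = (w * ((v : G)⁻¹ * (l * v * l⁻¹))) * l * (v : G)⁻¹ := by group
      _ = l * (w * (v : G)⁻¹) := by rw [h2]; group
  have : Fact (Nat.card P).Prime := ⟨hP.symm ▸ hp⟩
  rcases ((Subgroup.centralizer {l}).subgroupOf P).eq_bot_or_eq_top_of_prime_card with h | h
  · have hmem : w * v⁻¹ ∈ (Subgroup.centralizer {l}).subgroupOf P := by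
      rw [Subgroup.mem_subgroupOf, Subgroup.mem_centralizer_singleton_iff]
      exact hfix
    rw [h, Subgroup.mem_bot] at hmem
    exact (mul_inv_eq_one.1 hmem).symm
  · exfalso
    apply hl
    rw [Subgroup.mem_centralizer_iff]
    intro x hx
    have : (⟨x, hx⟩ : P) ∈ (Subgroup.centralizer {l}).subgroupOf P := by
      rw [h]; exact Subgroup.mem_top _
    rw [Subgroup.mem_subgroupOf, Subgroup.mem_centralizer_singleton_iff] at this
    exact this

theorem commutatorMap_eq_one {G : Type*} [Group G] {P : Subgroup G} [P.Normal] {l : G}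
    (hl : l ∈ Subgroup.centralizer (P : Set G)) (v : P) : commutatorMap P l v = 1 := by
  apply Subtype.ext
  change (v : G)⁻¹ * (l * v * l⁻¹) = 1
  rw [← Subgroup.mem_centralizer_iff.1 hl v v.2, mul_inv_cancel_right, inv_mul_cancel]

/-- Uniqueness of the factorization along `PH` separates the two components of the equation; the
component in `P` is rearranged using that `P` is commutative. -/
theorem commute_mul_mul_iff {G : Type*} [Group G] {p : ℕ} (hp : p.Prime) {P H : Subgroup G}
    [P.Normal] (hP : Nat.card P = p) (hPH : P ⊓ H = ⊥) (v w : P) (h l : H) :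
    Commute ((v : G) * h) (w * l) ↔
      Commute h l ∧ commutatorMap P l v = commutatorMap P h w := by
  have hinj : ∀ (a b : P) (c d : H), (a : G) * c = b * d → a = b ∧ c = d := by
    intro a b c d habcd
    have h1 : (b : G)⁻¹ * a = d * (c : G)⁻¹ := by
      rw [eq_mul_inv_iff_mul_eq, mul_assoc, habcd, inv_mul_cancel_left]
    have h2 : (b : G)⁻¹ * a ∈ P ⊓ H :=
      ⟨P.mul_mem (P.inv_mem b.2) a.2, h1 ▸ H.mul_mem d.2 (H.inv_mem c.2)⟩
    rw [hPH, Subgroup.mem_bot] at h2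
    refine ⟨Subtype.ext (inv_mul_eq_one.1 h2).symm, Subtype.ext ?_⟩
    rw [h2, eq_comm, mul_inv_eq_one] at h1
    exact h1.symm
  have hc : ∀ x : G, ∀ y ∈ P, x * y * x⁻¹ ∈ P := fun x y hy =>
    Subgroup.Normal.conj_mem ‹_› y hy x
  have e1 : (v : G) * h * (w * l) = (v * (h * w * (h : G)⁻¹)) * (h * l) := by group
  have e2 : (w : G) * l * (v * h) = (w * (l * v * (l : G)⁻¹)) * (l * h) := by group
  have hkey : (v : G) * (h * w * (h : G)⁻¹) = w * (l * v * (l : G)⁻¹) ↔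
      commutatorMap P l v = commutatorMap P h w := by
    rw [Subtype.ext_iff]
    change _ ↔ (v : G)⁻¹ * (l * v * (l : G)⁻¹) = (w : G)⁻¹ * (h * w * (h : G)⁻¹)
    rw [inv_mul_eq_iff_eq_mul, ← mul_assoc (v : G) (w : G)⁻¹,
      mul_comm_of_prime_card hp hP v.2 (inv_mem w.2), mul_assoc (w : G)⁻¹ (v : G),
      eq_inv_mul_iff_mul_eq, eq_comm]
  rw [← hkey]
  constructor
  · intro hcomm
    have h3 : (v : G) * h * (w * l) = w * l * (v * h) := hcomm.eq
    rw [e1, e2] at h3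
    obtain ⟨h4, h5⟩ := hinj ⟨_, mul_mem v.2 (hc h w w.2)⟩ ⟨_, mul_mem w.2 (hc l v v.2)⟩
      (h * l) (l * h) h3
    exact ⟨h5, congrArg Subtype.val h4⟩
  · rintro ⟨h3, h4⟩
    have h5 : (h : G) * l = l * h := congrArg Subtype.val h3.eq
    change (v : G) * h * (w * l) = w * l * (v * h)
    rw [e1, e2, h4, h5]

/-- Commuting pairs in the extension of a normal subgroup of prime order by a complement. -/
theorem commPairs_sup {G : Type*} [Group G] [Finite G] {p : ℕ} (hp : p.Prime) {P H : Subgroup G}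
    [P.Normal] (hP : Nat.card P = p) (hPH : P ⊓ H = ⊥) :
    commPairs (P ⊔ H) = p * commPairs H +
      (p ^ 2 - p) * commPairs (H ⊓ Subgroup.centralizer (P : Set G)) := by
  classical
  set C := Subgroup.centralizer (P : Set G)
  let e₁ : (Σ x : {x : H × H // Commute x.1 x.2},
      {y : P × P // commutatorMap P x.1.2 y.1 = commutatorMap P x.1.1 y.2}) →
      {x : (P ⊔ H : Subgroup G) × (P ⊔ H : Subgroup G) // Commute x.1 x.2} := fun z =>
    ⟨(⟨z.2.1.1 * z.1.1.1, Subgroup.mul_mem_sup z.2.1.1.2 z.1.1.1.2⟩,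
      ⟨z.2.1.2 * z.1.1.2, Subgroup.mul_mem_sup z.2.1.2.2 z.1.1.2.2⟩), Subtype.ext
        ((commute_mul_mul_iff hp hP hPH z.2.1.1 z.2.1.2 z.1.1.1 z.1.1.2).2 ⟨z.1.2, z.2.2⟩).eq⟩
  have he₁ : Function.Bijective e₁ := by
    have hd := Subgroup.mul_injective_of_disjoint (disjoint_iff.2 hPH)
    constructor
    · rintro ⟨⟨⟨h, l⟩, hhl⟩, ⟨v, w⟩, hvw⟩ ⟨⟨⟨h', l'⟩, hhl'⟩, ⟨v', w'⟩, hvw'⟩ heq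
      have h1 : (v : G) * h = v' * h' := congrArg (fun z => (z.1.1 : G)) heq
      have h2 : (w : G) * l = w' * l' := congrArg (fun z => (z.1.2 : G)) heq
      have h3 := @hd (v, h) (v', h') h1
      have h4 := @hd (w, l) (w', l') h2
      simp only [Prod.mk.injEq] at h3 h4
      obtain ⟨rfl, rfl⟩ := h3
      obtain ⟨rfl, rfl⟩ := h4
      rfl
    · rintro ⟨⟨⟨a, ha⟩, ⟨b, hb⟩⟩, hab⟩
      obtain ⟨v, hv, h, hh, rfl⟩ := Subgroup.mem_sup_of_normal_left.1 ha
      obtain ⟨w, hw, l, hl, rfl⟩ := Subgroup.mem_sup_of_normal_left.1 hb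
      have h1 := (commute_mul_mul_iff hp hP hPH ⟨v, hv⟩ ⟨w, hw⟩ ⟨h, hh⟩ ⟨l, hl⟩).1
        (congrArg Subtype.val hab.eq)
      exact ⟨⟨⟨(⟨h, hh⟩, ⟨l, hl⟩), h1.1⟩, (⟨v, hv⟩, ⟨w, hw⟩), h1.2⟩, rfl⟩
  have := Fintype.ofFinite {x : H × H // Commute x.1 x.2}
  rw [commPairs, ← Nat.card_congr (Equiv.ofBijective e₁ he₁), Nat.card_sigma]
  have hp2 : p ≤ p ^ 2 := Nat.le_self_pow two_ne_zero p
  -- If `h` or `l` moves `P`, one commutator map is bijective and one coordinate determines the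
  -- other: `p` solutions. If both centralize `P`, all `p ^ 2` pairs are solutions.
  have hfib : ∀ x : {x : H × H // Commute x.1 x.2},
      Nat.card {y : P × P // commutatorMap P x.1.2 y.1 = commutatorMap P x.1.1 y.2} =
        p + (p ^ 2 - p) * (if (x.1.1 : G) ∈ C ∧ (x.1.2 : G) ∈ C then 1 else 0) := by
    rintro ⟨⟨h, l⟩, hhl⟩
    by_cases hl : (l : G) ∈ C
    · by_cases hh : (h : G) ∈ C
      · rw [if_pos ⟨hh, hl⟩, mul_one, Nat.add_sub_cancel' hp2]
        rw [Nat.card_congr (Equiv.subtypeUnivEquiv fun y => by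
          rw [commutatorMap_eq_one hl, commutatorMap_eq_one hh]), Nat.card_prod, hP, sq]
      · rw [if_neg fun h => hh h.1, mul_zero, add_zero, ← hP]
        rw [← card_fiber_product _ (commutatorMap P l) (commutatorMap_bijective hp hP hh)]
        exact Nat.card_congr ((Equiv.prodComm _ _).subtypeEquiv fun a => eq_comm)
    · rw [if_neg fun h => hl h.2, mul_zero, add_zero, ← hP]
      exact card_fiber_product _ (commutatorMap P h) (commutatorMap_bijective hp hP hl)
  rw [Finset.sum_congr rfl fun x _ => hfib x, Finset.sum_add_distrib, Finset.sum_const,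
    Finset.card_univ, ← Nat.card_eq_fintype_card, smul_eq_mul, mul_comm, ← Finset.mul_sum,
    Finset.sum_boole, commPairs, commPairs]
  congr 2
  rw [Nat.cast_id, ← Fintype.card_subtype, ← Nat.card_eq_fintype_card]
  refine Nat.card_congr ⟨fun x => ⟨(⟨x.1.1.1, x.1.1.1.2, x.2.1⟩, ⟨x.1.1.2, x.1.1.2.2, x.2.2⟩),
      Subtype.ext (congrArg Subtype.val x.1.2.eq :)⟩,
    fun x => ⟨⟨(⟨x.1.1, x.1.1.2.1⟩, ⟨x.1.2, x.1.2.2.1⟩),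
      Subtype.ext (congrArg Subtype.val x.2.eq :)⟩, x.1.1.2.2, x.1.2.2.2⟩,
    fun _ => rfl, fun _ => rfl⟩

/-! ### Invariance, the symmetry between π and π', and use of minimality. -/

theorem IsHallSubgroup.map_mulEquiv {π : Set Nat.Primes} {G H : Type*} [Group G] [Group H]
    (e : G ≃* H) {A : Subgroup G} (hA : IsHallSubgroup π A) :
    IsHallSubgroup π (A.map e.toMonoidHom) := by
  constructor
  · rw [Subgroup.card_map_of_injective (f := e.toMonoidHom) e.injective]
    exact hA.1
  · have h : (A.map e.toMonoidHom).index = A.index := Subgroup.index_map_equiv A e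
    rw [h]
    exact hA.2

theorem IsConStar.congr {π : Set Nat.Primes} {G H : Type*} [Group G] [Group H] (e : G ≃* H)
    (hG : IsConStar π G) : IsConStar π H := by
  intro A B hA hB
  have hA' : ccl (A.map e.symm.toMonoidHom) = ccl A :=
    (ccl_congr (A.equivMapOfInjective e.symm.toMonoidHom e.symm.injective)).symm
  have hB' : ccl (B.map e.symm.toMonoidHom) = ccl B :=
    (ccl_congr (B.equivMapOfInjective e.symm.toMonoidHom e.symm.injective)).symm
  have h := hG _ _ (hA.map_mulEquiv e.symm) (hB.map_mulEquiv e.symm)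
  rw [hA', hB', ccl_congr e] at h
  refine h.imp id ?_
  rintro ⟨f⟩
  exact ⟨(e.symm.trans f).trans (MulEquiv.prodCongr
    (A.equivMapOfInjective e.symm.toMonoidHom e.symm.injective).symm
    (B.equivMapOfInjective e.symm.toMonoidHom e.symm.injective).symm)⟩

theorem IsConStar.compl {π : Set Nat.Primes} {G : Type*} [Group G] (hG : IsConStar π G) :
    IsConStar πᶜ G := by
  intro A B hA hB
  rw [compl_compl] at hB
  rw [mul_comm]
  exact (hG B A hB hA).imp id fun ⟨f⟩ => ⟨f.trans MulEquiv.prodComm⟩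

theorem IsMinimalConStarCounterexample.compl {π : Set Nat.Primes} {G : Type*} [Group G]
    (hG : IsMinimalConStarCounterexample π G) : IsMinimalConStarCounterexample πᶜ G where
  finite := hG.finite
  soluble := hG.soluble
  not_conStar h := hG.not_conStar (compl_compl π ▸ h.compl)
  section_conStar K N _ h := (hG.section_conStar K N h).compl

theorem ccl_prod_le (A B : Type*) [Group A] [Group B] [Finite A] [Finite B] :
    ccl (A × B) ≤ ccl A * ccl B := by
  rw [ccl, ccl, ccl, ← Nat.card_prod]
  choose ra hra using fun α : ConjClasses A => ConjClasses.exists_rep α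
  choose rb hrb using fun β : ConjClasses B => ConjClasses.exists_rep β
  refine Nat.card_le_card_of_surjective (fun x => ConjClasses.mk (ra x.1, rb x.2)) fun x => ?_
  obtain ⟨⟨a, b⟩, rfl⟩ := ConjClasses.exists_rep x
  refine ⟨(ConjClasses.mk a, ConjClasses.mk b), ?_⟩
  obtain ⟨c, hc⟩ := isConj_iff.1 (ConjClasses.mk_eq_mk_iff_isConj.1 (hra (ConjClasses.mk a)))
  obtain ⟨d, hd⟩ := isConj_iff.1 (ConjClasses.mk_eq_mk_iff_isConj.1 (hrb (ConjClasses.mk b)))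
  exact ConjClasses.mk_eq_mk_iff_isConj.2 (isConj_iff.2 ⟨(c, d), Prod.ext hc hd⟩)

/-- The isomorphism is abstract and need not respect the inclusions of `A` and `B`, but coprimality
of the orders still forces each of them into its own factor. -/
theorem IsHallSubgroup.commute_of_mulEquiv {π : Set Nat.Primes} {G : Type*} [Group G] [Finite G]
    {A B : Subgroup G} (hA : IsHallSubgroup π A) (hB : IsHallSubgroup πᶜ B) (e : G ≃* A × B)
    {a b : G} (ha : a ∈ A) (hb : b ∈ B) : Commute a b := by
  have hcop := hA.1.coprime hB.1
  have key : ∀ (X : Subgroup G) (x : G), x ∈ X → (e x) ^ Nat.card X = 1 := by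
    intro X x hx
    rw [← map_pow]
    have : (⟨x, hx⟩ : X) ^ Nat.card X = 1 := pow_card_eq_one'
    have h2 : x ^ Nat.card X = 1 := congrArg Subtype.val this
    rw [h2, map_one]
  have h1 : (e a).2 = 1 := by
    have h2 : (e a).2 ^ Nat.card A = 1 := congrArg Prod.snd (key A a ha)
    have h3 : (e a).2 ^ Nat.card B = 1 := pow_card_eq_one'
    have := pow_gcd_eq_one.2 ⟨h2, h3⟩
    rwa [hcop, pow_one] at this
  have h2 : (e b).1 = 1 := by
    have h2 : (e b).1 ^ Nat.card B = 1 := congrArg Prod.fst (key B b hb)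
    have h3 : (e b).1 ^ Nat.card A = 1 := pow_card_eq_one'
    have := pow_gcd_eq_one.2 ⟨h2, h3⟩
    rwa [hcop.symm, pow_one] at this
  apply e.injective
  rw [map_mul, map_mul]
  apply Prod.ext
  · rw [Prod.fst_mul, Prod.fst_mul, h2, mul_one, one_mul]
  · rw [Prod.snd_mul, Prod.snd_mul, h1, mul_one, one_mul]

/-- Minimality for a proper subgroup, multiplied through by its order; in the direct product case
the internal commutation is recovered from the abstract isomorphism. -/
theorem IsMinimalConStarCounterexample.ccl_subgroup {π : Set Nat.Primes} {G : Type*} [Group G]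
    (hG : IsMinimalConStarCounterexample π G) {K A B : Subgroup G} (hK : K ≠ ⊤) (hAK : A ≤ K)
    (hBK : B ≤ K) (hA : IsPiNumber π (Nat.card A)) (hB : IsPiNumber πᶜ (Nat.card B))
    (hcard : Nat.card A * Nat.card B = Nat.card K) :
    commPairs K < commPairs A * commPairs B ∨
      commPairs K ≤ commPairs A * commPairs B ∧ ∀ a ∈ A, ∀ b ∈ B, Commute a b := by
  have := hG.finite
  have hcK : IsConStar π K :=
    (hG.section_conStar K ⊥ (Or.inl hK)).congr QuotientGroup.quotientBot
  let eA := Subgroup.subgroupOfEquivOfLe hAK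
  let eB := Subgroup.subgroupOfEquivOfLe hBK
  have hA' : Nat.card (A.subgroupOf K) = Nat.card A := Nat.card_congr eA.toEquiv
  have hB' : Nat.card (B.subgroupOf K) = Nat.card B := Nat.card_congr eB.toEquiv
  obtain ⟨h1, h2⟩ := IsHallSubgroup.of_card_mul_card (hA' ▸ hA) (hB' ▸ hB)
    (by rw [hA', hB', hcard])
  have hpos : 0 < Nat.card K := Nat.card_pos
  have hmul : commPairs A * commPairs B = ccl A * ccl B * Nat.card K := by
    rw [commPairs_eq, commPairs_eq, ← hcard]; ring
  rw [hmul, commPairs_eq]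
  have h3 := hcK _ _ h1 h2
  rw [ccl_congr eA, ccl_congr eB] at h3
  rcases h3 with h3 | ⟨⟨e⟩⟩
  · exact Or.inl (Nat.mul_lt_mul_of_pos_right h3 hpos)
  · right
    constructor
    · refine Nat.mul_le_mul_right _ ?_
      rw [ccl_congr e, ← ccl_congr eA, ← ccl_congr eB]
      exact ccl_prod_le _ _
    · intro a ha b hb
      have := h1.commute_of_mulEquiv h2 e (a := ⟨a, hAK ha⟩) (b := ⟨b, hBK hb⟩) ha hb
      exact congrArg Subtype.val this.eq

/-! ### Normal subgroups of prime order. -/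

theorem Subgroup.sup_inf_eq_and_card {G : Type*} [Group G] [Finite G] {P H S : Subgroup G}
    [P.Normal] (hPH : P ⊔ H = ⊤) (hcop : (Nat.card P).Coprime (Nat.card H)) (hS : P ≤ S) :
    P ⊔ (H ⊓ S) = S ∧ Nat.card P * Nat.card (H ⊓ S : Subgroup G) = Nat.card S := by
  have hsup : P ⊔ (H ⊓ S) = S := by
    refine le_antisymm (sup_le hS inf_le_right) fun s hs => ?_
    have : s ∈ P ⊔ H := hPH ▸ Subgroup.mem_top s
    obtain ⟨x, hx, y, hy, rfl⟩ := Subgroup.mem_sup_of_normal_left.1 this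
    refine Subgroup.mul_mem_sup hx ⟨hy, ?_⟩
    simpa using mul_mem (inv_mem (hS hx)) hs
  refine ⟨hsup, Nat.dvd_antisymm ?_ ?_⟩
  · exact (hcop.coprime_dvd_right (Subgroup.card_dvd_of_le inf_le_left)).mul_dvd_of_dvd_of_dvd
      (Subgroup.card_dvd_of_le hS) (Subgroup.card_dvd_of_le inf_le_right)
  · conv_lhs => rw [← hsup]
    rw [sup_comm, mul_comm]
    exact card_sup_dvd_mul_card _ _

/-- If `p ^ 2` did not divide, `P` would have a complement `H ⊇ B`. With `c` counting commuting
pairs and `C = C_G(P)`, `commPairs_sup` expresses `c(G)` through `c(H)` and `c(H ∩ C)`, and `c(A)`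
through the intersections of these with `A`. Minimality for `H` and `H ∩ C` compares the two term by
term. -/
theorem IsMinimalConStarCounterexample.sq_dvd_of_mem {π : Set Nat.Primes} {G : Type*}
    [Group G] (hG : IsMinimalConStarCounterexample π G) {p : ℕ} (hp : p.Prime)
    (hpπ : (⟨p, hp⟩ : Nat.Primes) ∈ π) {P : Subgroup G} [P.Normal] (hP : Nat.card P = p) :
    p ^ 2 ∣ Nat.card G := by
  by_contra hp2
  have := hG.finite
  have := hG.soluble
  have hnot := hG.not_conStar
  simp only [IsConStar, not_forall, not_or] at hnot
  obtain ⟨A, B, hA, hB, hlt, hiso⟩ := hnot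
  have hPA : P ≤ A := hA.normal_le (by
    have := IsPiNumber.prime_pow hpπ 1
    rw [pow_one] at this
    exact hP.symm ▸ this)
  have hidx : ¬ p ∣ P.index := fun h => hp2 (by
    rw [← P.card_mul_index, hP, sq]
    exact mul_dvd_mul_left p h)
  have hcopi : (Nat.card P).Coprime P.index := by
    rw [hP]
    exact (Nat.Prime.coprime_iff_not_dvd hp).2 hidx
  obtain ⟨H₀, hH₀⟩ := Subgroup.exists_right_complement'_of_coprime hcopi
  have hH₀c : Nat.card H₀ = P.index := Nat.eq_of_mul_eq_mul_left Nat.card_pos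
    (hH₀.card_mul_card.trans P.card_mul_index.symm)
  have hH₀i : H₀.index = p := by
    have h1 := H₀.card_mul_index
    rw [← P.card_mul_index, hH₀c, hP, mul_comm] at h1
    exact Nat.eq_of_mul_eq_mul_right (Nat.pos_of_ne_zero Subgroup.index_ne_zero_of_finite) h1
  -- `H₀` is a Hall subgroup for the primes other than `p`, so a conjugate of it contains `B`.
  let ρ : Set Nat.Primes := {⟨p, hp⟩}ᶜ
  have hH₀ρ : IsHallSubgroup ρ H₀ := by
    constructor
    · rintro q hq rfl
      exact hidx (hH₀c ▸ hq)
    · rw [hH₀i, compl_compl]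
      intro q hq
      exact Subtype.ext ((Nat.prime_dvd_prime_iff_eq q.2 hp).1 hq)
  obtain ⟨g, hg⟩ := hH₀ρ.exists_map_conj_le (X := B) (by
    rintro q hq rfl
    exact hB.1 _ hq hpπ)
  rw [Subgroup.exists_le_map_conj_iff] at hg
  obtain ⟨H, hBH, hHc⟩ : ∃ H : Subgroup G, B ≤ H ∧ Nat.card H = P.index := by
    refine ⟨H₀.map (MulAut.conj g⁻¹).toMonoidHom, fun b hb => ⟨_, hg b hb, ?_⟩, ?_⟩
    · simp [mul_assoc]
    · rw [Subgroup.card_map_of_injective (f := (MulAut.conj g⁻¹).toMonoidHom)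
        (MulAut.conj g⁻¹).injective, hH₀c]
  have hcop : (Nat.card P).Coprime (Nat.card H) := hHc ▸ hcopi
  have hPHc : Nat.card P * Nat.card H = Nat.card G := hHc ▸ P.card_mul_index
  have hcomp : P.IsComplement' H := Subgroup.isComplement'_of_coprime hPHc hcop
  have hsup : P ⊔ H = ⊤ := hcomp.sup_eq_top
  have hinf : P ⊓ H = ⊥ := disjoint_iff.1 hcomp.disjoint
  have hHtop : H ≠ ⊤ := by
    rintro rfl
    rw [inf_top_eq] at hinf
    rw [hinf, Subgroup.card_bot] at hP
    exact hp.one_lt.ne hP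
  let C := Subgroup.centralizer (P : Set G)
  have hPC : P ≤ C := fun x hx => Subgroup.mem_centralizer_iff.2 fun y hy =>
    mul_comm_of_prime_card hp hP hy hx
  obtain ⟨hAs, hAc⟩ := Subgroup.sup_inf_eq_and_card hsup hcop hPA
  obtain ⟨-, hCc⟩ := Subgroup.sup_inf_eq_and_card hsup hcop hPC
  obtain ⟨-, hACc⟩ := Subgroup.sup_inf_eq_and_card hsup hcop (le_inf hPA hPC)
  have hABc := hA.card_mul_card hB
  have hACBC := hA.card_inf_mul_card_inf hB C
  have hPpos : 0 < Nat.card P := Nat.card_pos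
  have hHcard : Nat.card (H ⊓ A : Subgroup G) * Nat.card B = Nat.card H := by
    apply Nat.eq_of_mul_eq_mul_left hPpos
    rw [← mul_assoc, hAc, hABc, hPHc]
  have hKcard : Nat.card (H ⊓ (A ⊓ C) : Subgroup G) * Nat.card (B ⊓ C : Subgroup G) =
      Nat.card (H ⊓ C : Subgroup G) := by
    apply Nat.eq_of_mul_eq_mul_left hPpos
    rw [← mul_assoc, hACc, hACBC, hCc]
  have hKtop : H ⊓ C ≠ ⊤ := fun h => hHtop (top_le_iff.1 (h ▸ inf_le_left))
  have hconH := hG.ccl_subgroup hHtop (A := H ⊓ A) inf_le_left hBH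
    (hA.1.of_dvd (Subgroup.card_dvd_of_le inf_le_right)) hB.1 hHcard
  have hconK := hG.ccl_subgroup hKtop (A := H ⊓ (A ⊓ C)) (B := B ⊓ C)
    (inf_le_inf_left H inf_le_right) (inf_le_inf_right C hBH)
    (hA.1.of_dvd (Subgroup.card_dvd_of_le (inf_le_right.trans inf_le_left)))
    (hB.1.of_dvd (Subgroup.card_dvd_of_le inf_le_left)) hKcard
  have hKle : commPairs (H ⊓ C) ≤ commPairs (H ⊓ (A ⊓ C)) * commPairs (B ⊓ C) :=
    hconK.elim le_of_lt And.left
  have hcG := commPairs_sup hp hP hinf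
  have hcA := commPairs_sup hp hP (H := H ⊓ A)
    (le_bot_iff.1 ((inf_le_inf_left P inf_le_left).trans hinf.le))
  rw [hsup] at hcG
  rw [hAs, inf_assoc] at hcA
  have hgoal : ¬ commPairs (⊤ : Subgroup G) < commPairs A * commPairs B := by
    intro h
    rw [commPairs_eq, commPairs_eq, commPairs_eq, Subgroup.card_top, ← hABc,
      ccl_congr Subgroup.topEquiv, mul_mul_mul_comm] at h
    exact hlt (Nat.lt_of_mul_lt_mul_right h)
  have hpp : 0 < p ^ 2 - p := by
    rw [sq, Nat.sub_pos_iff_lt]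
    exact lt_mul_of_one_lt_left hp.pos hp.one_lt
  apply hgoal
  rw [hcG, hcA, add_mul, mul_assoc, mul_assoc]
  -- Strictness: if `B` centralizes `P`, it comes from `H`, since a direct decomposition of `H`
  -- would extend to `G`. Otherwise `B ⊓ C` is proper in `B` and the second term is strict.
  by_cases hBC : B ≤ C
  · rw [inf_eq_left.2 hBC] at hKle
    rcases hconH with h | ⟨-, h⟩
    · exact add_lt_add_of_lt_of_le (Nat.mul_lt_mul_of_pos_left h hp.pos)
        (Nat.mul_le_mul_left _ hKle)
    · exfalso
      refine hiso (nonempty_mulEquiv_prod_of_commute hA hB fun a ha b hb => ?_) |>.elim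
      rw [← hAs] at ha
      obtain ⟨x, hx, y, hy, rfl⟩ := Subgroup.mem_sup_of_normal_left.1 ha
      exact Commute.mul_left (Subgroup.mem_centralizer_iff.1 (hBC hb) x hx) (h y hy b hb)
  · have hlt' : commPairs (B ⊓ C) < commPairs B := commPairs_lt (inf_lt_left.2 hBC)
    refine add_lt_add_of_le_of_lt (Nat.mul_le_mul_left _ (hconH.elim le_of_lt And.left))
      (Nat.mul_lt_mul_of_pos_left (hKle.trans_lt ?_) hpp)
    exact Nat.mul_lt_mul_of_pos_left hlt' (commPairs_pos _)

/-- In a minimal counterexample, the order of a normal subgroup of prime order `p` is not the full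
`p`-part of the group order. -/
theorem IsMinimalConStarCounterexample.sq_dvd {π : Set Nat.Primes} {G : Type*}
    [Group G] (hG : IsMinimalConStarCounterexample π G) {p : ℕ} (hp : p.Prime)
    {P : Subgroup G} [P.Normal] (hP : Nat.card P = p) : p ^ 2 ∣ Nat.card G := by
  by_cases hpπ : (⟨p, hp⟩ : Nat.Primes) ∈ π
  · exact hG.sq_dvd_of_mem hp hpπ hP
  · exact hG.compl.sq_dvd_of_mem hp hpπ hP

/-! ### Action on normal subgroups of prime power order. -/

/-- In a finite soluble group, a normal subgroup centralizing every normal subgroup of prime power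
order is abelian. -/
theorem le_map_center_of_forall_le_centralizer {G : Type*} [Group G] [Finite G]
    [Group.IsSolvable G] {C : Subgroup G} (hCn : C.Normal)
    (hC : ∀ (q : ℕ) (N : Subgroup G), q.Prime → N.Normal → IsPGroup q N →
      C ≤ Subgroup.centralizer (N : Set G)) : C ≤ (Subgroup.center C).map C.subtype := by
  obtain ⟨Z, hZdef⟩ : ∃ Z : Subgroup G, Z = (Subgroup.center C).map C.subtype := ⟨_, rfl⟩
  rw [← hZdef]
  have hZn : Z.Normal := by rw [hZdef]; infer_instance
  have hZC : Z ≤ C := hZdef ▸ Subgroup.map_subtype_le _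
  have hZcomm : ∀ z ∈ Z, ∀ c ∈ C, c * z = z * c := by
    rw [hZdef]
    rintro _ ⟨z, hz, rfl⟩ c hc
    exact congrArg Subtype.val (Subgroup.mem_center_iff.1 hz ⟨c, hc⟩)
  by_contra hCZ
  let π := QuotientGroup.mk' Z
  have hXn : (C.map π).Normal := hCn.map π (QuotientGroup.mk'_surjective Z)
  have hXnt : Nontrivial (C.map π) := by
    rw [Subgroup.nontrivial_iff_ne_bot, Ne, Subgroup.map_eq_bot_iff, QuotientGroup.ker_mk']
    exact hCZ
  obtain ⟨q, N₀, hq, hN₀c, hN₀, -, hN₀q⟩ := exists_characteristic_isPGroup (C.map π)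
  have := Fact.mk hq
  let N : Subgroup (G ⧸ Z) := N₀.map (C.map π).subtype
  have hNn : N.Normal := inferInstance
  have hNq : IsPGroup q N := hN₀q.map _
  have hNX : N ≤ C.map π := Subgroup.map_subtype_le _
  let M := N.comap π
  have hMn : M.Normal := hNn.comap π
  have hMC : M ≤ C := by
    have := Subgroup.comap_mono (f := π) hNX
    rwa [Subgroup.comap_map_eq, QuotientGroup.ker_mk', sup_eq_left.2 hZC] at this
  let f : M →* N := π.subgroupComap N
  have hker : ∀ x : M, f x = 1 ↔ (x : G) ∈ Z := fun x => by
    rw [Subtype.ext_iff]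
    exact QuotientGroup.eq_one_iff (x : G)
  have hkerc : f.ker ≤ Subgroup.center M := by
    intro x hx
    rw [Subgroup.mem_center_iff]
    intro y
    exact Subtype.ext (hZcomm x ((hker x).1 hx) y (hMC y.2))
  have hNnil : Group.IsNilpotent N := hNq.isNilpotent
  have hMnil : Group.IsNilpotent M := Subgroup.isNilpotent_of_ker_le_center f hkerc
  -- As `M` is nilpotent, `Q` is characteristic in it and so normal in `G`. By hypothesis `C`
  -- centralizes `Q`, whence `Q ≤ Z`; but then `M / Z` is a `q`-group of order prime to `q`.
  obtain ⟨Q⟩ := (inferInstance : Nonempty (Sylow q M))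
  have hQn : (Q : Subgroup M).Normal := Q.normal_of_normalizerCondition
    Group.normalizerCondition_of_isNilpotent
  have hQc := Q.characteristic_of_normal hQn
  have hQG : ((Q : Subgroup M).map M.subtype).Normal := inferInstance
  have hCQ := hC q _ hq hQG (Q.2.map _)
  have hQker : (Q : Subgroup M) ≤ f.ker := by
    intro x hx
    rw [MonoidHom.mem_ker, hker]
    have hxQ : (x : G) ∈ (Q : Subgroup M).map M.subtype := ⟨x, hx, rfl⟩
    rw [hZdef]
    refine ⟨⟨x, hMC x.2⟩, ?_, rfl⟩
    rw [SetLike.mem_coe, Subgroup.mem_center_iff]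
    intro c
    exact Subtype.ext (Subgroup.mem_centralizer_iff.1 (hCQ c.2) x hxQ).symm
  have hfs : Function.Surjective f := by
    rintro ⟨y, hy⟩
    obtain ⟨x, rfl⟩ := QuotientGroup.mk'_surjective Z y
    exact ⟨⟨x, hy⟩, rfl⟩
  have hidx : f.ker.index = Nat.card N := by
    rw [Subgroup.index_ker, MonoidHom.range_eq_top.2 hfs, Subgroup.card_top]
  have hdvd : Nat.card N ∣ (Q : Subgroup M).index := hidx ▸ Subgroup.index_dvd_of_le hQker
  have hN1 : Nat.card N = 1 := by
    rcases hNq.card_eq_or_dvd with h1 | h1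
    · exact h1
    · exact absurd (h1.trans hdvd) Q.not_dvd_index
  rw [Subgroup.card_eq_one] at hN1
  exact hN₀ ((Subgroup.map_eq_bot_iff_of_injective _ (C.map π).subtype_injective).1 hN1)

/-- A Sylow subgroup of a finite soluble group which centralizes every normal subgroup of prime
power order is normal. -/
theorem Sylow.normal_of_forall_le_centralizer {G : Type*} [Group G] [Finite G]
    [Group.IsSolvable G] {p : ℕ} [Fact p.Prime] (S : Sylow p G)
    (h : ∀ (q : ℕ) (N : Subgroup G), q.Prime → N.Normal → IsPGroup q N →
      (S : Subgroup G) ≤ Subgroup.centralizer (N : Set G)) : (S : Subgroup G).Normal := by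
  obtain ⟨C, hCn, hSC, hC⟩ : ∃ C : Subgroup G, C.Normal ∧ (S : Subgroup G) ≤ C ∧
      ∀ (q : ℕ) (N : Subgroup G), q.Prime → N.Normal → IsPGroup q N →
        C ≤ Subgroup.centralizer (N : Set G) := by
    -- The common centralizer of all normal subgroups of prime power order is normal, and abelian by
    -- the preceding lemma, so its Sylow subgroup `S` is characteristic in it.
    let U : Set G := {x | ∃ (q : ℕ) (N : Subgroup G), q.Prime ∧ N.Normal ∧ IsPGroup q N ∧ x ∈ N}
    refine ⟨Subgroup.centralizer U, ⟨fun c hc g => ?_⟩, ?_, ?_⟩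
    · rw [Subgroup.mem_centralizer_iff] at hc ⊢
      rintro x ⟨q, N, hq, hN, hNq, hx⟩
      have h1 := hc (g⁻¹ * x * g) ⟨q, N, hq, hN, hNq, by simpa using hN.conj_mem x hx g⁻¹⟩
      calc x * (g * c * g⁻¹) = g * (g⁻¹ * x * g * c) * g⁻¹ := by group
        _ = g * c * g⁻¹ * x := by rw [h1]; group
    · intro s hs
      rw [Subgroup.mem_centralizer_iff]
      rintro x ⟨q, N, hq, hN, hNq, hx⟩
      exact Subgroup.mem_centralizer_iff.1 (h q N hq hN hNq hs) x hx
    · exact fun q N hq hN hNq => Subgroup.centralizer_le fun x hx => ⟨q, N, hq, hN, hNq, hx⟩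
  let Z : Subgroup G := (Subgroup.center C).map C.subtype
  have hZcomm : ∀ z ∈ Z, ∀ c ∈ C, c * z = z * c := by
    rintro _ ⟨z, hz, rfl⟩ c hc
    exact congrArg Subtype.val (Subgroup.mem_center_iff.1 hz ⟨c, hc⟩)
  have hCZ : C ≤ Z := le_map_center_of_forall_le_centralizer hCn hC
  let T : Sylow p C := S.subtype hSC
  have hTn : (T : Subgroup C).Normal := by
    constructor
    intro n hn g
    have : g * n = n * g := Subtype.ext (hZcomm n (hCZ n.2) g g.2)
    rwa [this, mul_inv_cancel_right]
  have hTc := T.characteristic_of_normal hTn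
  have hT : (T : Subgroup C).map C.subtype = S := by
    rw [Sylow.coe_subtype, Subgroup.map_subgroupOf_eq_of_le hSC]
  rw [← hT]
  infer_instance

/-- A `p`-subgroup `S` acting by conjugation on a normal subgroup `N` fixes `|N|` points
modulo `p`. -/
theorem IsPGroup.card_modEq_card_inf_centralizer {G : Type*} [Group G] [Finite G] {p : ℕ}
    [Fact p.Prime] {S : Subgroup G} (hS : IsPGroup p S) (N : Subgroup G) [N.Normal] :
    Nat.card N ≡ Nat.card (N ⊓ Subgroup.centralizer (S : Set G) : Subgroup G) [MOD p] := by
  let := MulAction.compHom N ((MulAut.conjNormal (H := N)).comp S.subtype)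
  refine (hS.card_modEq_card_fixedPoints N).trans ?_
  have hfix : ∀ x : N, x ∈ MulAction.fixedPoints S N ↔
      (x : G) ∈ Subgroup.centralizer (S : Set G) := by
    intro x
    rw [MulAction.mem_fixedPoints, Subgroup.mem_centralizer_iff, Subtype.forall]
    refine forall₂_congr fun s hs => ?_
    rw [Subtype.ext_iff]
    change s * (x : G) * s⁻¹ = x ↔ _
    rw [mul_inv_eq_iff_eq_mul]
  rw [Nat.card_congr (⟨fun x => ⟨x.1, x.1.2, (hfix x.1).1 x.2⟩,
    fun x => ⟨⟨x.1, x.2.1⟩, (hfix ⟨x.1, x.2.1⟩).2 x.2.2⟩, fun _ => rfl, fun _ => rfl⟩ :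
    MulAction.fixedPoints S N ≃ (N ⊓ Subgroup.centralizer (S : Set G) : Subgroup G))]

/-- If a prime `p` divides the order of a minimal counterexample exactly once, then some Sylow
`p`-subgroup acts nontrivially on a normal `q`-subgroup, and `q ^ 2` divides the group order. -/
theorem IsMinimalConStarCounterexample.exists_not_le_centralizer {π : Set Nat.Primes}
    {G : Type*} [Group G] (hG : IsMinimalConStarCounterexample π G) {p : ℕ} (hp : p.Prime)
    (h1 : p ∣ Nat.card G) (h2 : ¬ p ^ 2 ∣ Nat.card G) :
    ∃ (q : ℕ) (N S : Subgroup G), q.Prime ∧ q ≠ p ∧ q ^ 2 ∣ Nat.card G ∧ N.Normal ∧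
      IsPGroup q N ∧ IsPGroup p S ∧ ¬ N ≤ Subgroup.centralizer (S : Set G) := by
  have := hG.finite
  have := hG.soluble
  have := Fact.mk hp
  obtain ⟨S⟩ := (inferInstance : Nonempty (Sylow p G))
  have hSn : ¬ (S : Subgroup G).Normal := by
    intro hn
    have hS : Nat.card S = p := by
      have hf : (Nat.card G).factorization p = 1 := by
        apply le_antisymm
        · by_contra! h
          exact h2 ((hp.pow_dvd_iff_le_factorization Nat.card_pos.ne').2 h)
        · exact (hp.dvd_iff_one_le_factorization Nat.card_pos.ne').1 h1
      rw [S.card_eq_multiplicity, hf, pow_one]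
    exact h2 (hG.sq_dvd hp hS)
  have hex := mt S.normal_of_forall_le_centralizer hSn
  push Not at hex
  obtain ⟨q, N, hq, hN, hNq, hSN⟩ := hex
  have := Fact.mk hq
  have hNS : ¬ N ≤ Subgroup.centralizer ((S : Subgroup G) : Set G) := fun h =>
    hSN (Subgroup.le_centralizer_iff.1 h)
  have hN1 : N ≠ ⊥ := by
    rintro rfl
    exact hNS bot_le
  obtain ⟨k, hk⟩ := IsPGroup.iff_card.1 hNq
  have hk0 : k ≠ 0 := by
    rintro rfl
    exact hN1 (Subgroup.card_eq_one.1 hk)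
  have hq2 : q ^ 2 ∣ Nat.card G := by
    by_cases hk1 : k = 1
    · rw [hk1, pow_one] at hk
      exact hG.sq_dvd hq hk
    · exact (pow_dvd_pow q (by omega)).trans (hk ▸ N.card_subgroup_dvd_card)
  exact ⟨q, N, S, hq, fun h => h2 (h ▸ hq2), hq2, hN, hNq, S.2, hNS⟩

/-- The fixed points of `S` on `N` form a proper subgroup of order congruent to `|N|` modulo `p`;
the common power of `q` cancels. -/
theorem IsPGroup.exists_dvd_pow_sub_one {G : Type*} [Group G] [Finite G] {p q : ℕ} (hp : p.Prime)
    (hq : q.Prime) (hqp : q ≠ p) {N S : Subgroup G} [N.Normal] (hN : IsPGroup q N)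
    (hS : IsPGroup p S) (hNS : ¬ N ≤ Subgroup.centralizer (S : Set G)) :
    ∃ j k, j < k ∧ p ∣ q ^ (k - j) - 1 ∧ Nat.card N = q ^ k ∧
      Nat.card (N ⊓ Subgroup.centralizer (S : Set G) : Subgroup G) = q ^ j := by
  have := Fact.mk hp
  have := Fact.mk hq
  obtain ⟨k, hk⟩ := IsPGroup.iff_card.1 hN
  obtain ⟨j, hj⟩ := IsPGroup.iff_card.1
    (hN.to_le (inf_le_left : N ⊓ Subgroup.centralizer (S : Set G) ≤ N))
  have hjk : j < k := by
    by_contra! h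
    refine hNS (inf_eq_left.1 (Subgroup.eq_of_le_of_card_ge inf_le_left ?_))
    rw [hk, hj]
    exact Nat.pow_le_pow_right hq.pos h
  refine ⟨j, k, hjk, ?_, hk, hj⟩
  have hmod := hS.card_modEq_card_inf_centralizer N
  rw [hk, hj] at hmod
  have h1 : p ∣ q ^ k - q ^ j :=
    (Nat.modEq_iff_dvd' (Nat.pow_le_pow_right hq.pos hjk.le)).1 hmod.symm
  have h2 : q ^ k - q ^ j = q ^ j * (q ^ (k - j) - 1) := by
    rw [Nat.mul_sub, mul_one, ← pow_add, Nat.add_sub_cancel' hjk.le]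
  rw [h2] at h1
  refine (Nat.Coprime.pow_right j ?_).dvd_of_dvd_mul_left h1
  exact (Nat.coprime_primes hp hq).2 hqp.symm

/-! ### The numerical sieve. -/

/-- The primes below `45`. -/
def primesBelow45 : List ℕ := [2, 3, 5, 7, 11, 13, 17, 19, 23, 29, 31, 37, 41, 43]

/-- A sufficient numerical condition for groups of order `m` to be harmless as Hall subgroups. -/
def isSmallOrder (m : ℕ) : Bool :=
  m == 1 || m == 15 || m == 35 || m == 45 ||
    primesBelow45.any fun p => m == p || m == p * p || m == p * p * p

/-- If `p` divides `n` exactly once, then `p ∣ q ^ i - 1` for some `q ^ i ∣ n` with `q ^ 2 ∣ n`. -/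
def exactPrimeTest (n p : ℕ) : Bool :=
  !(n % p == 0) || n % (p * p) == 0 || primesBelow45.any fun q =>
    n % (q * q) == 0 && (List.range 10).any fun i =>
      n % q ^ (i + 1) == 0 && (q ^ (i + 1) - 1) % p == 0

/-- The numerical restrictions on the orders `a`, `b` of the two Hall subgroups. -/
def orderTest (a b : ℕ) : Bool :=
  !(Nat.gcd a b == 1) || isSmallOrder b || !((primesBelow45.prod ^ 10) % (a * b) == 0) ||
    !(primesBelow45.all (exactPrimeTest (a * b))) ||
    [336, 672, 1008, 1200, 1296, 1344, 1680].any (fun n => n == a * b) ||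
    (b == 81 && (a == 10 || a == 20))

theorem orderTest_eq_true : ((List.range 45).all fun a => isSmallOrder a ||
    (List.range (2000 / a + 1)).all (orderTest a)) = true := by decide +kernel

theorem mem_primesBelow45 {p : ℕ} (hp : p.Prime) (h : p < 45) : p ∈ primesBelow45 := by
  revert hp
  revert p
  decide

theorem prime_of_mem_primesBelow45 {p : ℕ} (h : p ∈ primesBelow45) : p.Prime := by
  revert p
  simp only [primesBelow45, List.forall_mem_cons, List.not_mem_nil, false_imp_iff, implies_true,
    and_true]
  norm_num

theorem dvd_prod_primesBelow45_pow {n : ℕ} (hn0 : n ≠ 0) (hn : n ≤ 2000)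
    (h : ∀ p, p.Prime → p ∣ n → p < 45) : n ∣ primesBelow45.prod ^ 10 := by
  rw [Nat.dvd_iff_prime_pow_dvd_dvd]
  intro p k hp hk
  rcases Nat.eq_zero_or_pos k with rfl | hk0
  · rw [pow_zero]; exact one_dvd _
  have hpn : p ∣ n := (dvd_pow_self p hk0.ne').trans hk
  -- `2 ^ 11 = 2048` already exceeds the bound 2000.
  have hk10 : k ≤ 10 := by
    by_contra! hk11
    have h1 : 2 ^ 11 ≤ p ^ k := (Nat.pow_le_pow_left hp.two_le 11).trans
      (Nat.pow_le_pow_right hp.pos hk11)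
    have h2 := Nat.le_of_dvd (Nat.pos_of_ne_zero hn0) hk
    omega
  exact (pow_dvd_pow p hk10).trans
    (pow_dvd_pow_of_dvd (List.dvd_prod (mem_primesBelow45 hp (h p hp hpn))) 10)

/-- The divisibility condition satisfied by the order of a minimal counterexample. -/
def ExactPrimesDivide (n : ℕ) : Prop :=
  ∀ p, p.Prime → p ∣ n → ¬ p ^ 2 ∣ n →
    ∃ q i, q.Prime ∧ q ≠ p ∧ q ^ 2 ∣ n ∧ q ^ (i + 1) ∣ n ∧ p ∣ q ^ (i + 1) - 1

/-- Either `p ^ 2 ∣ n`, or `p * q ^ (i + 1) ∣ n` with `p < q ^ (i + 1)`. In both cases `p ^ 2 ≤ 2000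
< 45 ^ 2`. -/
theorem ExactPrimesDivide.prime_lt {n : ℕ} (hn0 : n ≠ 0) (hn : n ≤ 2000)
    (h : ExactPrimesDivide n) {p : ℕ} (hp : p.Prime) (hpn : p ∣ n) : p < 45 := by
  have hsq : ∀ q, q ^ 2 ∣ n → q < 45 := fun q hq => by
    by_contra! h45
    have h1 := Nat.le_of_dvd (Nat.pos_of_ne_zero hn0) hq
    have h2 := Nat.pow_le_pow_left h45 2
    omega
  by_cases hp2 : p ^ 2 ∣ n
  · exact hsq p hp2
  · obtain ⟨q, i, hq, hqp, -, hqi, hpq⟩ := h p hp hpn hp2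
    have hcop : p.Coprime (q ^ (i + 1)) :=
      Nat.Coprime.pow_right _ ((Nat.coprime_primes hp hq).2 hqp.symm)
    have h1 := Nat.le_of_dvd (Nat.pos_of_ne_zero hn0)
      (hcop.mul_dvd_of_dvd_of_dvd hpn hqi)
    have h2 : 1 < q ^ (i + 1) := Nat.one_lt_pow i.succ_ne_zero hq.one_lt
    have h3 := Nat.le_of_dvd (Nat.sub_pos_of_lt h2) hpq
    by_contra! h45
    have h4 : 45 * 45 ≤ p * q ^ (i + 1) := Nat.mul_le_mul h45 (by omega)
    omega

theorem ExactPrimesDivide.exactPrimeTest_eq_true {n : ℕ} (hn0 : n ≠ 0) (hn : n ≤ 2000)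
    (h : ExactPrimesDivide n) {p : ℕ} (hp : p.Prime) : exactPrimeTest n p = true := by
  by_cases hpn : p ∣ n
  · by_cases hp2 : p ^ 2 ∣ n
    · simp [exactPrimeTest, ← sq, Nat.mod_eq_zero_of_dvd hp2]
    · obtain ⟨q, i, hq, -, hq2, hqi, hpq⟩ := h p hp hpn hp2
      have hqm := mem_primesBelow45 hq
        (h.prime_lt hn0 hn hq ((dvd_pow_self q two_ne_zero).trans hq2))
      have hi : i < 10 := by
        by_contra! hi
        have h1 : 2 ^ 11 ≤ q ^ (i + 1) := (Nat.pow_le_pow_left hq.two_le 11).trans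
          (Nat.pow_le_pow_right hq.pos (by omega))
        have h2 := Nat.le_of_dvd (Nat.pos_of_ne_zero hn0) hqi
        omega
      rw [exactPrimeTest, Bool.or_eq_true, List.any_eq_true]
      right
      refine ⟨q, hqm, ?_⟩
      rw [Bool.and_eq_true, List.any_eq_true]
      refine ⟨by simpa [← sq] using Nat.mod_eq_zero_of_dvd hq2, i, List.mem_range.2 hi, ?_⟩
      simp [Nat.mod_eq_zero_of_dvd hqi, Nat.mod_eq_zero_of_dvd hpq]
  · have : n % p ≠ 0 := fun h => hpn (Nat.dvd_of_mod_eq_zero h)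
    simp [exactPrimeTest, this]

theorem ExactPrimesDivide.orders {a b : ℕ} (hab : a ≤ b) (hn0 : a * b ≠ 0) (hn : a * b ≤ 2000)
    (hcop : a.Coprime b) (h : ExactPrimesDivide (a * b)) (ha : isSmallOrder a = false)
    (hb : isSmallOrder b = false) :
    (a * b = 336 ∨ a * b = 672 ∨ a * b = 1008 ∨ a * b = 1200 ∨ a * b = 1296 ∨ a * b = 1344 ∨
      a * b = 1680) ∨ b = 81 ∧ (a = 10 ∨ a = 20) := by
  have ha0 : 0 < a := Nat.pos_of_ne_zero (left_ne_zero_of_mul hn0)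
  have ha45 : a < 45 := by
    by_contra! h45
    have : 45 * 45 ≤ a * b := Nat.mul_le_mul h45 (h45.trans hab)
    omega
  have hb2 : b < 2000 / a + 1 :=
    Nat.lt_succ_of_le ((Nat.le_div_iff_mul_le ha0).2 (mul_comm a b ▸ hn))
  have hall := List.all_eq_true.1 orderTest_eq_true a (List.mem_range.2 ha45)
  rw [ha, Bool.false_or] at hall
  have htest := List.all_eq_true.1 hall b (List.mem_range.2 hb2)
  have h1 : (Nat.gcd a b == 1) = true := beq_iff_eq.2 hcop
  have h2 : ((primesBelow45.prod ^ 10) % (a * b) == 0) = true := beq_iff_eq.2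
    (Nat.mod_eq_zero_of_dvd (dvd_prod_primesBelow45_pow hn0 hn fun p hp hpn =>
      h.prime_lt hn0 hn hp hpn))
  have h3 : (primesBelow45.all (exactPrimeTest (a * b))) = true := List.all_eq_true.2 fun p hp =>
    h.exactPrimeTest_eq_true hn0 hn (prime_of_mem_primesBelow45 hp)
  rw [orderTest, h1, h2, h3, hb] at htest
  simp only [Bool.not_true, Bool.false_or, Bool.or_eq_true, Bool.and_eq_true, beq_iff_eq,
    List.any_cons, List.any_nil, Bool.or_false] at htest
  omega

/-! ### Applying the sieve, and the orders 810 and 1620. -/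

theorem IsMinimalConStarCounterexample.exactPrimesDivide {π : Set Nat.Primes} {G : Type*}
    [Group G] (hG : IsMinimalConStarCounterexample π G) : ExactPrimesDivide (Nat.card G) := by
  have := hG.finite
  intro p hp h1 h2
  obtain ⟨q, N, S, hq, hqp, hq2, hN, hNq, hS, hNS⟩ := hG.exists_not_le_centralizer hp h1 h2
  obtain ⟨j, k, hjk, hdvd, hk, -⟩ := hNq.exists_dvd_pow_sub_one hp hq hqp hS hNS
  refine ⟨q, k - j - 1, hq, hqp, hq2, ?_, ?_⟩
  · rw [Nat.sub_add_cancel (by omega)]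
    exact (pow_dvd_pow q (Nat.sub_le k j)).trans (hk ▸ N.card_subgroup_dvd_card)
  · rwa [Nat.sub_add_cancel (by omega)]

theorem ccl_lt_of_isSmallOrder {G : Type*} [Group G] [Finite G]
    (hG : isSmallOrder (Nat.card G) = true) (H : Subgroup G) (hH : H ≠ ⊤) : ccl H < ccl G := by
  simp only [isSmallOrder, Bool.or_eq_true, beq_iff_eq, List.any_eq_true] at hG
  rcases hG with (((h | h) | h) | h) | ⟨p, hp, (h | h) | h⟩
  · have := (Nat.card_eq_one_iff_unique.1 h).1
    exact ccl_lt_of_ne_top_of_comm (fun a b => Subsingleton.elim _ _) H hH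
  · exact ccl_lt_of_ne_top_of_comm (mul_comm_of_card_eq (Or.inl h)) H hH
  · exact ccl_lt_of_ne_top_of_comm (mul_comm_of_card_eq (Or.inr (Or.inl h))) H hH
  · exact ccl_lt_of_ne_top_of_comm (mul_comm_of_card_eq (Or.inr (Or.inr h))) H hH
  all_goals
    have hp' := prime_of_mem_primesBelow45 hp
    have := Fact.mk hp'
  · have : IsCyclic G := isCyclic_of_prime_card h
    exact ccl_lt_of_ne_top_of_comm (fun a b => Std.Commutative.comm a b) H hH
  · have := IsPGroup.isMulCommutative_of_card_eq_prime_sq (h.trans (sq p).symm)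
    exact ccl_lt_of_ne_top_of_comm (fun a b => Std.Commutative.comm a b) H hH
  · exact ccl_lt_of_ne_top_of_card_eq_prime_pow_three hp' (h.trans (by ring)) H hH

/-- In a minimal counterexample of order `810` or `1620`, a Hall subgroup of order `81` is abelian,
since an element of order `5` acts on it without fixed points. -/
theorem IsMinimalConStarCounterexample.mul_comm_of_card_eq_81 {π : Set Nat.Primes} {G : Type*}
    [Group G] (hG : IsMinimalConStarCounterexample π G)
    (hcard : Nat.card G = 810 ∨ Nat.card G = 1620) {B : Subgroup G} (hB : IsHallSubgroup π B)
    (hBc : Nat.card B = 81) (x y : B) : x * y = y * x := by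
  have := hG.finite
  have hp : Nat.Prime 5 := by norm_num
  have := Fact.mk hp
  obtain ⟨q, N, S, hq, hqp, hq2, hN, hNq, hS, hNS⟩ := hG.exists_not_le_centralizer hp
    (by rcases hcard with h | h <;> rw [h] <;> norm_num)
    (by rcases hcard with h | h <;> rw [h] <;> norm_num)
  have := Fact.mk hq
  obtain ⟨j, k, hjk, hdvd, hk, hj⟩ := hNq.exists_dvd_pow_sub_one hp hq hqp hS hNS
  have hkG : q ^ k ∣ Nat.card G := hk ▸ N.card_subgroup_dvd_card
  have hq23 : q = 2 ∨ q = 3 := by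
    have hdvd : q ^ 2 ∣ 2 ^ 2 * 3 ^ 4 * 5 := hq2.trans
      (by rcases hcard with h | h <;> rw [h] <;> norm_num)
    have hq' : q ∣ 2 ^ 2 * 3 ^ 4 * 5 := (dvd_pow_self q two_ne_zero).trans hdvd
    rcases (Nat.Prime.dvd_mul hq).1 hq' with h | h
    · rcases (Nat.Prime.dvd_mul hq).1 h with h | h
      · exact Or.inl ((Nat.prime_dvd_prime_iff_eq hq Nat.prime_two).1 (hq.dvd_of_dvd_pow h))
      · exact Or.inr ((Nat.prime_dvd_prime_iff_eq hq Nat.prime_three).1 (hq.dvd_of_dvd_pow h))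
    · exact absurd ((Nat.prime_dvd_prime_iff_eq hq hp).1 h) hqp
  have hG' : Nat.card G ∣ 1620 := by rcases hcard with h | h <;> rw [h]; norm_num
  have hkG' := hkG.trans hG'
  have hq3 : q = 3 := by
    refine hq23.resolve_left ?_
    rintro rfl
    have hk3 : k < 3 := by
      by_contra! h
      exact absurd ((pow_dvd_pow 2 h).trans hkG') (by norm_num)
    interval_cases k <;> interval_cases j <;> revert hdvd <;> decide
  subst hq3
  have hk5 : ∀ i, 3 ^ i ∣ 1620 → i < 5 := by
    intro i hi
    by_contra! h
    exact absurd ((pow_dvd_pow 3 h).trans hi) (by norm_num)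
  -- The order of 3 modulo 5 is 4, so `S` moves a full `3 ^ 4` and fixes only the identity.
  have hkj : k = 4 ∧ j = 0 := by
    have := hk5 k hkG'
    clear hkG hkG' hk hj
    interval_cases k <;> interval_cases j <;> revert hdvd <;> decide
  obtain ⟨rfl, rfl⟩ := hkj
  have hfix : N ⊓ Subgroup.centralizer (S : Set G) = ⊥ := Subgroup.card_eq_one.1 hj
  have hNB : N = B := by
    have h1 : N ≤ B := hB.normal_le (by
      rw [hk, show 3 ^ 4 = Nat.card B by rw [hBc]; norm_num]
      exact hB.1)
    exact Subgroup.eq_of_le_of_card_ge h1 (by rw [hBc, hk]; norm_num)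
  -- The center of `N` is again a nontrivial normal 3-subgroup on which `S` has no nontrivial fixed
  -- point, so it too has order `3 ^ 4` and equals `N`.
  let Z : Subgroup G := (Subgroup.center N).map N.subtype
  have hZn : Z.Normal := inferInstance
  have hZN : Z ≤ N := Subgroup.map_subtype_le _
  have hZq : IsPGroup 3 Z := hNq.to_le hZN
  have hZ1 : Z ≠ ⊥ := by
    have hnt : Nontrivial N := Finite.one_lt_card_iff_nontrivial.1 (by rw [hk]; norm_num)
    have := hNq.bot_lt_center
    rw [Ne, Subgroup.map_eq_bot_iff_of_injective _ N.subtype_injective]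
    exact this.ne'
  have hZfix : Z ⊓ Subgroup.centralizer (S : Set G) = ⊥ :=
    le_bot_iff.1 ((inf_le_inf_right _ hZN).trans hfix.le)
  have hZS : ¬ Z ≤ Subgroup.centralizer (S : Set G) := fun h =>
    hZ1 (by rw [← hZfix, inf_eq_left.2 h])
  obtain ⟨j, k, hjk, hdvd', hk', hj'⟩ := hZq.exists_dvd_pow_sub_one hp hq hqp hS hZS
  have hk4 : k = 4 := by
    have := hk5 k ((hk' ▸ Z.card_subgroup_dvd_card).trans hG')
    clear hk' hj'
    interval_cases k <;> interval_cases j <;> revert hdvd' <;> decide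
  have hZeq : Z = N := Subgroup.eq_of_le_of_card_ge hZN (by rw [hk, hk', hk4])
  have hx : (x : G) ∈ Z := by rw [hZeq, hNB]; exact x.2
  obtain ⟨x', hx', hxx⟩ := hx
  have hyN : (y : G) ∈ N := hNB ▸ y.2
  have := congrArg Subtype.val (Subgroup.mem_center_iff.1 hx' ⟨y, hyN⟩)
  apply Subtype.ext
  change (x : G) * y = y * x
  rw [← hxx]
  exact this.symm

theorem IsMinimalConStarCounterexample.card_of_card_le {π : Set Nat.Primes} {G : Type*} [Group G]
    (hG : IsMinimalConStarCounterexample π G) (hcard : Nat.card G ≤ 2000) {A B : Subgroup G}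
    (hA : IsHallSubgroup π A) (hB : IsHallSubgroup πᶜ B) (hle : Nat.card A ≤ Nat.card B)
    (hlt : ¬ ccl G < ccl A * ccl B) (hiso : ¬ Nonempty (G ≃* A × B)) :
    Nat.card G = 336 ∨ Nat.card G = 672 ∨ Nat.card G = 1008 ∨ Nat.card G = 1200 ∨
      Nat.card G = 1296 ∨ Nat.card G = 1344 ∨ Nat.card G = 1680 := by
  have := hG.finite
  have := hG.soluble
  have hmul := hA.card_mul_card hB
  have hA' : ¬ ∀ H : Subgroup A, H ≠ ⊤ → ccl H < ccl A := fun h =>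
    (hA.ccl_lt_or_of_forall_ccl_lt hB h).elim hlt hiso
  have hB' : ¬ ∀ H : Subgroup B, H ≠ ⊤ → ccl H < ccl B := fun h =>
    (hB.ccl_lt_or_of_forall_ccl_lt ((compl_compl π).symm ▸ hA) h).elim
      (fun h => hlt (mul_comm (ccl B) (ccl A) ▸ h))
      (fun ⟨e⟩ => hiso ⟨e.trans MulEquiv.prodComm⟩)
  have hsA : isSmallOrder (Nat.card A) = false := by
    rw [← Bool.not_eq_true]
    exact fun h => hA' (ccl_lt_of_isSmallOrder h)
  have hsB : isSmallOrder (Nat.card B) = false := by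
    rw [← Bool.not_eq_true]
    exact fun h => hB' (ccl_lt_of_isSmallOrder h)
  rw [← hmul] at hcard ⊢
  refine (ExactPrimesDivide.orders hle (hmul ▸ Nat.card_pos.ne') hcard (hA.1.coprime hB.1)
    (hmul ▸ hG.exactPrimesDivide) hsA hsB).resolve_right ?_
  rintro ⟨hb, ha⟩
  refine hB' (ccl_lt_of_ne_top_of_comm (hG.compl.mul_comm_of_card_eq_81 ?_ hB hb))
  rw [← hmul, hb]
  omega

theorem mainTheorem8 (π : Set Nat.Primes) (G : Type*) [Group G]
    (hG : IsMinimalConStarCounterexample π G) (hcard : Nat.card G ≤ 2000) :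
    Nat.card G = 336 ∨ Nat.card G = 672 ∨ Nat.card G = 1008 ∨ Nat.card G = 1200 ∨
      Nat.card G = 1296 ∨ Nat.card G = 1344 ∨ Nat.card G = 1680 := by
  have hnot := hG.not_conStar
  simp only [IsConStar, not_forall, not_or] at hnot
  obtain ⟨A, B, hA, hB, hlt, hiso⟩ := hnot
  rcases le_total (Nat.card A) (Nat.card B) with h | h
  · exact hG.card_of_card_le hcard hA hB h hlt hiso
  · exact hG.compl.card_of_card_le hcard hB ((compl_compl π).symm ▸ hA) h
      (fun h => hlt (mul_comm (ccl B) (ccl A) ▸ h))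
      (fun ⟨e⟩ => hiso ⟨e.trans MulEquiv.prodComm⟩)
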